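/- Let $a,b,c$ be positive integers with $b\le c$. Consider $a$ independent simple symmetric random walks on $\mathbb Z$, the $j$-th one ($0\le j\le a-1$) started at $2j$ at time $0$, conditioned to end at $c-b+2j$ at time $b+c$ and not to intersect during the whole time interval $[0,b+c]$. Write $z^r_0<\dots<z^r_{a-1}$ for the positions at time $r$, so that $z^0_j=2j$ and $z^{b+c}_j=c-b+2j$. The law of $(z^r_j)_{0<r<b+c}$ is the probability measure on the ordered configurations in $(\mathbb Z^a)^{b+c-1}$ given by $$p(z)=\frac1{Z(a,b,c)}\prod_{r=0}^{b+c-1}\det\big(\phi(z^r_j,z^{r+1}_k)\big)_{j,k=0}^{a-1},\qquad \phi(x,y)=\delta_{x-1,y}+\delta_{x+1,y},$$ where $Z(a,b,c)$ is the number of families of non-intersecting paths with these end points. **Notation.** Put $1/m!=0$ for $m<0$ and $(t)_n=t(t+1)\cdots(t+n-1)$. For integers $\alpha,\beta\ge 0$ and $0\le n\le N$ the normalized associated Hahn polynomial is $$q^{(\alpha,\beta)}_{n,N}(x)=\frac{(-N-\beta)_n(-N)_n}{d^{(\alpha,\beta)}_{n,N}\,n!}\sum_{j=0}^n\binom nj(-1)^j\frac{(-x)_j(n-2N-\alpha-\beta-1)_j}{(-N-\beta)_j(-N)_j},$$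 where $d^{(\alpha,\beta)}_{n,N}>0$ and $$\big(d^{(\alpha,\beta)}_{n,N}\big)^2=\frac{(\alpha+\beta+N+1-n)_{N+1}}{(\alpha+\beta+2N+1-2n)\,n!\,(\beta+N-n)!\,(\alpha+N-n)!\,(N-n)!}.$$ Set $a_r=|c-r|$, $b_r=|b-r|$; $\alpha_r=-r$ for $0\le r\le b$ and $\alpha_r=r-2b$ for $b\le r\le b+c$; $\gamma_r=r+a-1$ for $0\le r\le b$, $\gamma_r=b+a-1$ for $b\le r\le c$ and $\gamma_r=a+b+c-1-r$ for $c\le r\le b+c$. Set $$\omega_r(x)=\begin{cases}\big((b_r+x)!\,(\gamma_r+a_r-x)!\big)^{-1},&0\le r\le b\\ \big(x!\,(\gamma_r+a_r-x)!\big)^{-1},&b\le r\le c\\ \big(x!\,(\gamma_r-x)!\big)^{-1},&c\le r\le b+c,\end{cases}$$ $$\tilde\omega_s(y)=\begin{cases}\big(y!\,(\gamma_s-y)!\big)^{-1},&0\le s\le b\\ \big((b_s+y)!\,(\gamma_s-y)!\big)^{-1},&b\le s\le c\\ \big((b_s+y)!\,(\gamma_s+a_s-y)!\big)^{-1},&c\le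 s\le b+c.\end{cases}$$ Finally let $\phi_{r,s}(u,v)=\binom{s-r}{(v-u+s-r)/2}$ if $r<s$ (which is $0$ unless the lower entry is an integer between $0$ and $s-r$) and $\phi_{r,s}\equiv0$ if $r\ge s$. **Theorem.** For $0<r<b+c$ all positions $z^r_j$ lie almost surely in $\alpha_r+2\mathbb Z$, and the positions of the walkers at the times $0<r<b+c$ form a determinantal point process: for every $k\ge 0$ and all distinct points $(r_1,\alpha_{r_1}+2x_1),\dots,(r_k,\alpha_{r_k}+2x_k)$ with $0<r_i<b+c$ and $x_i\in\mathbb Z$, the probability that for every $i$ there is a walker at $\alpha_{r_i}+2x_i$ at time $r_i$ equals $$\det\big(K_H(r_i,\alpha_{r_i}+2x_i;\,r_j,\alpha_{r_j}+2x_j)\big)_{i,j=1}^k,$$ where, for $0<r,s<b+c$ and $x,y\in\mathbb Z$, the extended Hahn kernel is $$K_H(r,\alpha_r+2x;s,\alpha_s+2y)=-\phi_{r,s}(\alpha_r+2x,\alpha_s+2y)+\sum_{n=0}^{a-1}\sqrt{\frac{(a+s-1-n)!\,(a+b+c-r-1-n)!}{(a+r-1-n)!\,(a+b+c-s-1-n)!}}\;q^{(b_r,a_r)}_{n,\gamma_r}(x)\,q^{(b_s,a_s)}_{n,\gamma_s}(y)\,\omega_r(x)\,\tilde\omega_s(y).$$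 -/

import Mathlib

open MeasureTheory ProbabilityTheory

noncomputable section

/-! ### The non-intersecting walk model -/

/-- The intermediate times `0 < r < b + c`. -/
abbrev InnerTime (b c : ℕ) : Type := Set.Ioo (0 : ℕ) (b + c)

/-- The configuration space `(ℤ^a)^(b+c-1)`: `z r j` is the position of particle `j` at time `r`. -/
abbrev Config (a b c : ℕ) : Type := InnerTime b c → Fin a → ℤ

/-- The position of particle `j` at time `t`, with the initial points `2j` (at time `0`) and the
final points `c - b + 2j` (at time `b + c`) put in. -/
def position {a b c : ℕ} (z : Config a b c) (t : ℕ) (j : Fin a) : ℤ :=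
  if h : t ∈ Set.Ioo (0 : ℕ) (b + c) then z ⟨t, h⟩ j
  else if t = 0 then 2 * (j : ℤ)
  else (c : ℤ) - b + 2 * (j : ℤ)

/-- The single step kernel `φ(x, y) = δ_{x-1,y} + δ_{x+1,y}`. -/
def stepKernel (x y : ℤ) : ℝ :=
  (if x - 1 = y then 1 else 0) + (if x + 1 = y then 1 else 0)

/-- The families of non-intersecting nearest neighbour paths, listed in increasing order, from the
points `2j` to the points `c - b + 2j`. -/
def nonintersectingConfigs (a b c : ℕ) : Set (Config a b c) :=
  {z | (∀ r, StrictMono (z r)) ∧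
    ∀ t < b + c, ∀ j, position z (t + 1) j = position z t j + 1 ∨
      position z (t + 1) j = position z t j - 1}

/-- `Z(a,b,c)`, the total number of non-intersecting configurations. -/
def partitionFunction (a b c : ℕ) : ℕ := Nat.card (nonintersectingConfigs a b c)

open Classical in
/-- The weight `p(z) = Z(a,b,c)⁻¹ ∏_{r=0}^{b+c-1} det (φ(z^r_j, z^{r+1}_k))_{j,k}` of a configuration
whose lines are listed in increasing order (there is no mass on other elements of
`(ℤ^a)^(b+c-1)`). -/
def configWeight (a b c : ℕ) (z : Config a b c) : ℝ :=
  if ∀ r, StrictMono (z r) then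
    (1 / (partitionFunction a b c : ℝ)) * ∏ t ∈ Finset.range (b + c),
      (Matrix.of fun j k : Fin a => stepKernel (position z t j) (position z (t + 1) k)).det
  else 0

/-- The measure on `(ℤ^a)^(b+c-1)` with density `configWeight` relative to counting measure. -/
def configMeasure (a b c : ℕ) : Measure (Config a b c) :=
  Measure.count.withDensity fun z => ENNReal.ofReal (configWeight a b c z)

/-- The variables `ξ j t` are independent fair signs: the steps of `a` independent simple
symmetric random walks. -/
structure IsFairSteps {Ω : Type*} [MeasurableSpace Ω] (P : Measure Ω) {a : ℕ}
    (ξ : Fin a → ℕ → Ω → ℤ) : Prop where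
  measurable : ∀ j t, Measurable (ξ j t)
  indep : iIndepFun (fun i : Fin a × ℕ => ξ i.1 i.2) P
  prob_up : ∀ j t, P {ω | ξ j t ω = 1} = 1 / 2
  prob_down : ∀ j t, P {ω | ξ j t ω = -1} = 1 / 2

/-- The position at time `t` of the `j`-th walk, which starts at `2j`. -/
def walk {Ω : Type*} {a : ℕ} (ξ : Fin a → ℕ → Ω → ℤ) (j : Fin a) (t : ℕ) (ω : Ω) : ℤ :=
  2 * (j : ℤ) + ∑ i ∈ Finset.range t, ξ j i ω

/-- The event that the walks end at the points `c - b + 2j` at time `b + c` and do not intersect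
in the whole time interval `[0, b + c]`. -/
def nonintersectionEvent {Ω : Type*} {a : ℕ} (b c : ℕ) (ξ : Fin a → ℕ → Ω → ℤ) : Set Ω :=
  {ω | (∀ j, walk ξ j (b + c) ω = (c : ℤ) - b + 2 * (j : ℤ)) ∧
    ∀ t ≤ b + c, ∀ i j, i ≠ j → walk ξ i t ω ≠ walk ξ j t ω}

/-! ### Determinantal point processes on a discrete space -/

/-- The random set `X` of particles in the discrete space `S` has determinantal correlation
functions with kernel `K`: the probability of finding particles at any finite list of distinct
points is the corresponding determinant. -/
def IsDeterminantal {Ω S : Type*} [MeasurableSpace Ω] (P : Measure Ω) (X : Ω → Set S)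
    (K : S → S → ℝ) : Prop :=
  ∀ (k : ℕ) (p : Fin k → S), Function.Injective p →
    P.real {ω | ∀ i, p i ∈ X ω} = (Matrix.of fun i j => K (p i) (p j)).det

/-! ### Associated Hahn polynomials -/

/-- `1 / m!`, with the convention that it is `0` for `m < 0`. -/
def invFact (m : ℤ) : ℝ := if 0 ≤ m then 1 / (m.toNat.factorial : ℝ) else 0

/-- The Pochhammer symbol `(x)_n = x (x + 1) ⋯ (x + n - 1)`. -/
def poch (x : ℝ) (n : ℕ) : ℝ := (ascPochhammer ℝ n).eval x

/-- The square of the normalization constant `d_{n,N}^{(α,β)}`. -/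
def hahnNormSq (α β N n : ℕ) : ℝ :=
  poch ((α : ℝ) + β + N + 1 - n) (N + 1) / ((α : ℝ) + β + 2 * N + 1 - 2 * n) *
    invFact n * invFact ((β : ℤ) + N - n) * invFact ((α : ℤ) + N - n) * invFact ((N : ℤ) - n)

/-- The normalized associated Hahn polynomial `q_{n,N}^{(α,β)}(x)`, for `0 ≤ n ≤ N`. -/
def hahnPoly (α β N n : ℕ) (x : ℝ) : ℝ :=
  poch (-(N : ℝ) - β) n * poch (-(N : ℝ)) n /
      (Real.sqrt (hahnNormSq α β N n) * (n.factorial : ℝ)) *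
    ∑ j ∈ Finset.range (n + 1), (n.choose j : ℝ) * (-1) ^ j *
      (poch (-x) j * poch ((n : ℝ) - 2 * N - α - β - 1) j) /
        (poch (-(N : ℝ) - β) j * poch (-(N : ℝ)) j)

/-! ### The extended Hahn kernel -/

/-- `a_r = |c - r|`. -/
def aPar (c r : ℕ) : ℕ := ((c : ℤ) - r).natAbs

/-- `b_r = |b - r|`. -/
def bPar (b r : ℕ) : ℕ := ((b : ℤ) - r).natAbs

/-- `α_r`: on line `r` the Hahn coordinate `x` stands for the position `α_r + 2x`. -/
def alphaPar (b r : ℕ) : ℤ := if r ≤ b then -(r : ℤ) else (r : ℤ) - 2 * b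

/-- `γ_r`. For `a > 0` and `r < b + c` no subtraction below is truncated. -/
def gammaPar (a b c r : ℕ) : ℕ :=
  if r ≤ b then r + a - 1 else if r ≤ c then b + a - 1 else a + b + c - 1 - r

/-- `ω_r(x)`. -/
def omegaPar (a b c r : ℕ) (x : ℤ) : ℝ :=
  if r ≤ b then invFact (bPar b r + x) * invFact (gammaPar a b c r + aPar c r - x)
  else if r ≤ c then invFact x * invFact (gammaPar a b c r + aPar c r - x)
  else invFact x * invFact (gammaPar a b c r - x)

/-- `ω̃_s(y)`. -/
def omegaTildePar (a b c s : ℕ) (y : ℤ) : ℝ :=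
  if s ≤ b then invFact y * invFact (gammaPar a b c s - y)
  else if s ≤ c then invFact (bPar b s + y) * invFact (gammaPar a b c s - y)
  else invFact (bPar b s + y) * invFact (gammaPar a b c s + aPar c s - y)

/-- `φ_{r,s}(u, v) = binom(s - r, (v - u + s - r) / 2)` if `r < s`, and `0` if `r ≥ s`. As usual
`binom(n, k) = 0` unless `k` is an integer with `0 ≤ k ≤ n`. -/
def transition (r s : ℕ) (u v : ℤ) : ℝ :=
  if r < s ∧ 2 ∣ v - u + s - r ∧ 0 ≤ v - u + s - r then
    ((s - r).choose ((v - u + s - r) / 2).toNat : ℝ)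
  else 0

/-- The extended Hahn kernel `K_H(r, α_r + 2x; s, α_s + 2y)`, as a function of the times `r, s` and
the Hahn coordinates `x, y`. -/
def hahnKernel (a b c : ℕ) (r : ℕ) (x : ℤ) (s : ℕ) (y : ℤ) : ℝ :=
  -transition r s (alphaPar b r + 2 * x) (alphaPar b s + 2 * y) +
    ∑ n ∈ Finset.range a,
      Real.sqrt ((((a + s - 1 - n).factorial : ℝ) * ((a + b + c - r - 1 - n).factorial : ℝ)) /
        (((a + r - 1 - n).factorial : ℝ) * ((a + b + c - s - 1 - n).factorial : ℝ))) *
      hahnPoly (bPar b r) (aPar c r) (gammaPar a b c r) n x *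
      hahnPoly (bPar b s) (aPar c s) (gammaPar a b c s) n y *
      omegaPar a b c r x * omegaTildePar a b c s y

/-- The particles of a configuration, in Hahn coordinates: `(r, x)` belongs to the set when there is
a particle at position `α_r + 2x` at time `r`. -/
def particles {a b c : ℕ} (z : Config a b c) : Set (InnerTime b c × ℤ) :=
  {p | ∃ j, z p.1 j = alphaPar b p.1 + 2 * p.2}

end

/-! ### Minors of matrices -/

section Minors

variable {I : Type*} {a : ℕ}

/-! Write a position at time `t` as `-t + 2u`. In the coordinate `u` the walkers go from `j` to `c +
j` by steps that add 0 or 1. Between increasing configurations, the determinant of such one-step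
weights is the indicator of an admissible joint step (`det_upStep`). By Cauchy–Binet, passing to
minors respects products (`minorMatrix_mul`). So non-intersecting families are counted by a minor
`G` of `U ^ (b + c)`, where `U` is the one-step matrix and `U ^ s` has entries `binom(s, y - x)`.

For correlations, each prescribed space-time point receives the weight `1 + τ`. The weighted count
is `det G * det (1 + τ K)`, where `K = -W + v G⁻¹ u`. Here `W` holds the transition weights between
the points, and `u`, `v` those from the start and to the end (`det_weightedProd`). The top
coefficient in `τ` counts the families through all the points (`sum_minor_paths_through`).

It remains to invert `G`. The functions `hahnFun` are combinations of shifted binomials `binom(R -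
m, i - m)` whose coefficients do not involve `R`, so by Vandermonde `s` steps of evolution only
replace `R` by `R + s` (`hahnFun_evolve`). For the same reason the pairing of a forward and a
backward function is independent of time. It reduces to a Chu–Vandermonde sum that vanishes off the
diagonal (`sum_hahnFun_mul_hahnFun`, `hahnPairing_of_ne`). Hence `G⁻¹ = hahnEnd * hahnStart`, and `v
G⁻¹ u` becomes a sum over `n < a` of products of evolved functions.

Each `hahnFun` is a factorial weight times a terminating ₃F₂. The Thomae–Sheppard transformation
(`hahnSum_transform`) identifies this ₃F₂ with the Hahn polynomial in each of the three time ranges,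
which turns `K` into the extended Hahn kernel (`hahnKernel_term`).

As for the law, a non-intersecting configuration prescribes all `a (b + c)` steps, each of
probability 1/2. So the conditioned walks are uniform on these configurations, and so is the measure
defined by the determinants. -/

theorem det_mul_eq_sum_functions [Fintype I] (M : Matrix (Fin a) I ℝ) (N : Matrix I (Fin a) ℝ) :
    (M * N).det = ∑ f : Fin a → I, (∏ j, M j (f j)) * (N.submatrix f id).det := by
  have h : (M * N : Matrix (Fin a) (Fin a) ℝ) = fun j => ∑ i, M j i • N i := by
    ext j k
    simp [Matrix.mul_apply, Finset.sum_apply]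
  change Matrix.detRowAlternating (M * N) = _
  rw [h]
  change Matrix.detRowAlternating.toMultilinearMap (fun j => ∑ i, M j i • N i) = _
  rw [MultilinearMap.map_sum]
  refine Finset.sum_congr rfl fun f _ => ?_
  rw [MultilinearMap.map_smul_univ]
  rfl

/-- The **Cauchy–Binet formula**. -/
theorem det_mul_eq_sum_minors [Fintype I] [LinearOrder I] (M : Matrix (Fin a) I ℝ)
    (N : Matrix I (Fin a) ℝ) :
    (M * N).det = ∑ e : Fin a ↪o I, (M.submatrix id e).det * (N.submatrix e id).det := by
  rw [det_mul_eq_sum_functions]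
  have h : ∀ e : Fin a ↪o I, (M.submatrix id e).det * (N.submatrix e id).det =
      ∑ σ : Equiv.Perm (Fin a), (∏ j, M j (e (σ j))) * (N.submatrix (e ∘ σ) id).det := by
    intro e
    rw [← Matrix.det_transpose, Matrix.det_apply', Finset.sum_mul]
    refine Finset.sum_congr rfl fun σ _ => ?_
    have : N.submatrix (e ∘ σ) id = (N.submatrix e id).submatrix σ id := rfl
    rw [this, Matrix.det_permute]
    simp only [Matrix.transpose_apply, Matrix.submatrix_apply, id]
    ring
  simp_rw [h]
  rw [← Fintype.sum_prod_type' (f := fun (e : Fin a ↪o I) (σ : Equiv.Perm (Fin a)) =>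
      (∏ j, M j (e (σ j))) * (N.submatrix (e ∘ σ) id).det)]
  symm
  -- An injective function is uniquely an increasing embedding after a permutation; any other
  -- function repeats a row and contributes zero.
  refine Finset.sum_of_injOn (fun p : (Fin a ↪o I) × Equiv.Perm (Fin a) => p.1 ∘ p.2)
    ?_ (fun _ _ => Finset.mem_coe.2 (Finset.mem_univ _)) ?_ (fun _ _ => rfl)
  · rintro ⟨e, σ⟩ - ⟨e', σ'⟩ - heq
    have heq : (e : Fin a → I) ∘ σ = e' ∘ σ' := heq
    have hr : Set.range e = Set.range e' := by
      rw [← σ.surjective.range_comp e, heq, σ'.surjective.range_comp]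
    have he : e = e' := by
      have := (StrictMono.range_inj e.strictMono e'.strictMono).1 hr
      exact DFunLike.coe_injective this
    subst he
    have : σ = σ' := Equiv.ext fun j => e.injective (congrFun heq j)
    rw [this]
  · intro f _ hf
    by_cases hinj : Function.Injective f
    · exfalso
      apply hf
      have hs : StrictMono (f ∘ Tuple.sort f) :=
        (Tuple.monotone_sort f).strictMono_of_injective (hinj.comp (Tuple.sort f).injective)
      refine ⟨⟨OrderEmbedding.ofStrictMono _ hs, (Tuple.sort f)⁻¹⟩,
        Finset.mem_coe.2 (Finset.mem_univ _), ?_⟩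
      funext j
      simp
    · rw [Function.Injective] at hinj
      push Not at hinj
      obtain ⟨i, j, hij, hne⟩ := hinj
      rw [Matrix.det_zero_of_row_eq hne, mul_zero]
      funext k
      simp [hij]

/-- The matrix of all minors of size `a`. -/
def minorMatrix [LinearOrder I] (a : ℕ) (A : Matrix I I ℝ) : Matrix (Fin a ↪o I) (Fin a ↪o I) ℝ :=
  Matrix.of fun x y => (A.submatrix x y).det

theorem minorMatrix_mul [Fintype I] [LinearOrder I] (A B : Matrix I I ℝ) :
    minorMatrix a (A * B) = minorMatrix a A * minorMatrix a B := by
  ext x y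
  have h : (A * B).submatrix x y = A.submatrix x id * B.submatrix id y := by
    ext; simp [Matrix.mul_apply]
  rw [minorMatrix, Matrix.of_apply, h, det_mul_eq_sum_minors, Matrix.mul_apply]
  rfl

theorem strictMono_perm_eq_one (σ : Equiv.Perm (Fin a)) (h : StrictMono σ) : σ = 1 := by
  have := (StrictMono.range_inj h strictMono_id).1 (by simp [σ.surjective.range_eq])
  exact Equiv.ext fun j => congrFun this j

theorem minorMatrix_one [LinearOrder I] : minorMatrix a (1 : Matrix I I ℝ) = 1 := by
  ext x y
  rw [minorMatrix, Matrix.of_apply]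
  by_cases hxy : x = y
  · subst hxy
    rw [Matrix.one_apply_eq, Matrix.submatrix_one _ x.injective, Matrix.det_one]
  · rw [Matrix.one_apply_ne hxy]
    have : ∃ j, ∀ k, x j ≠ y k := by
      by_contra! hcon
      choose g hg using hcon
      have hgm : StrictMono g := fun i j hij => by
        rw [← y.lt_iff_lt, ← hg, ← hg]; exact x.strictMono hij
      have hgid : g = id := by
        have hgs : Function.Surjective g := Finite.surjective_of_injective hgm.injective
        exact (StrictMono.range_inj hgm strictMono_id).1 (by simp [hgs.range_eq])
      apply hxy
      ext j
      rw [hg, hgid]; rfl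
    -- Distinct embeddings of the same size have different ranges, so some `x j` is missed by `y`
    -- and gives a zero row.
    obtain ⟨j, hj⟩ := this
    exact Matrix.det_eq_zero_of_row_eq_zero j fun k => by simp [Matrix.one_apply_ne (hj k)]

/-- Summing a product of transition weights over all trajectories gives a matrix product. -/
theorem sum_paths_eq_prod {X : Type*} [Fintype X] [DecidableEq X] (n : ℕ)
    (M : ℕ → Matrix X X ℝ) (x y : X) :
    ∑ p : Fin (n + 1) → X, (if p 0 = x ∧ p (Fin.last n) = y then
      ∏ t : Fin n, M t (p t.castSucc) (p t.succ) else 0) =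
      ((List.range n).map M).prod x y := by
  induction n generalizing y with
  | zero =>
    simp only [Finset.univ_eq_empty, Finset.prod_empty, List.range_zero, List.map_nil,
      List.prod_nil, Fin.last_zero]
    rw [← (Equiv.funUnique (Fin 1) X).symm.sum_comp]
    simp only [Equiv.funUnique_symm_apply, uniqueElim_const, Matrix.one_apply]
    by_cases h : x = y
    · subst h; simp
    · rw [if_neg h]
      exact Finset.sum_eq_zero fun p _ => if_neg fun hp => h (hp.1.symm.trans hp.2)
  | succ n ih =>
    rw [List.range_succ, List.map_append, List.prod_append, Matrix.mul_apply]
    simp_rw [← ih]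
    rw [← (Fin.snocEquiv (fun _ : Fin (n + 2) => X)).sum_comp, Fintype.sum_prod_type]
    simp only [Fin.snocEquiv_apply, List.map_cons, List.map_nil, List.prod_cons, List.prod_nil,
      mul_one, Fin.snoc_last]
    rw [Finset.sum_eq_single y (fun q _ hq => Finset.sum_eq_zero fun p _ =>
      if_neg fun hp => hq hp.2) (by simp)]
    simp_rw [Finset.sum_mul]
    rw [Finset.sum_comm]
    refine Finset.sum_congr rfl fun p _ => ?_
    rw [Finset.sum_eq_single (p (Fin.last n)) (fun q _ hq => by
      rw [if_neg fun hp => hq hp.2.symm, zero_mul]) (by simp)]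
    have h0 : (Fin.snoc (α := fun _ : Fin (n + 2) => X) p y) 0 = p 0 :=
      Fin.snoc_castSucc (α := fun _ : Fin (n + 2) => X) y p 0
    rw [h0, Fin.prod_univ_castSucc]
    simp only [and_true]
    split_ifs with h
    · congr 1
      · refine Finset.prod_congr rfl fun t _ => ?_
        rw [Fin.snoc_castSucc, Fin.succ_castSucc, Fin.snoc_castSucc]
        rfl
      · rw [Fin.snoc_castSucc, Fin.succ_last, Fin.snoc_last]
        rfl
    · simp

theorem minorMatrix_list_prod [Fintype I] [LinearOrder I] (l : List (Matrix I I ℝ)) :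
    minorMatrix a l.prod = (l.map (minorMatrix a)).prod := by
  induction l with
  | nil => simp [minorMatrix_one]
  | cons A l ih => rw [List.prod_cons, minorMatrix_mul, ih, List.map_cons, List.prod_cons]

end Minors

/-! ### One step of non-intersecting walks, counting the steps upwards -/

/-- The transition weight of a walk which stays or moves up by one. -/
def upStep (x y : ℤ) : ℝ := if y = x ∨ y = x + 1 then 1 else 0

/-- A permutation contributes only if `y j` is `x (σ j)` or `x (σ j) + 1` for all `j`. For `i < j`
this gives `x (σ i) ≤ y i ≤ y j - 1 ≤ x (σ j)`, so `σ` is increasing and must be the identity.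
Crossings are thus excluded in a single step. -/
theorem det_upStep {a : ℕ} {x y : Fin a → ℤ} (hx : StrictMono x) (hy : StrictMono y) :
    (Matrix.of fun j k => upStep (x j) (y k)).det =
      if ∀ j, y j = x j ∨ y j = x j + 1 then 1 else 0 := by
  rw [Matrix.det_apply', Finset.sum_eq_single 1 _ (by simp)]
  · simp only [Equiv.Perm.sign_one, Equiv.Perm.one_apply, Matrix.of_apply, upStep,
      Finset.prod_ite_zero, Finset.prod_const_one]
    simp
  · intro σ _ hσ
    by_contra hne
    have h0 : ∀ j, y j = x (σ j) ∨ y j = x (σ j) + 1 := fun j => by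
      by_contra hj
      apply hne
      rw [Finset.prod_eq_zero (Finset.mem_univ j) (by simp [upStep, hj]), mul_zero]
    refine hσ (strictMono_perm_eq_one σ fun i j hij => ?_)
    have hle : x (σ i) ≤ x (σ j) := by
      have := hy hij
      have := h0 i
      have := h0 j
      omega
    exact lt_of_le_of_ne (hx.le_iff_le.1 hle) (σ.injective.ne hij.ne)

/-! ### Determinantal correlations of products of minors -/

section EynardMehta

variable {I : Type*} [Fintype I] [DecidableEq I] {k T : ℕ}

/-- The factor `1 + τ` at the points `(r i, q i)` on line `t`. -/
def pointWeight (r : Fin k → Fin T) (q : Fin k → I) (τ : ℝ) (t : ℕ) (x : I) : ℝ :=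
  ∏ i, if (r i : ℕ) = t ∧ q i = x then 1 + τ else 1

omit [Fintype I] in
theorem pointWeight_eq {r : Fin k → Fin T} {q : Fin k → I}
    (hinj : Function.Injective fun i => (r i, q i)) (τ : ℝ) (t : ℕ) (x : I) :
    pointWeight r q τ t x = 1 + τ * ∑ i, if (r i : ℕ) = t ∧ q i = x then 1 else 0 := by
  unfold pointWeight
  by_cases h : ∃ i, (r i : ℕ) = t ∧ q i = x
  · obtain ⟨i, hi⟩ := h
    have huniq : ∀ j, j ≠ i → ¬((r j : ℕ) = t ∧ q j = x) := fun j hj hj' =>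
      hj (hinj (Prod.ext (Fin.ext (hj'.1.trans hi.1.symm)) (hj'.2.trans hi.2.symm)))
    rw [Finset.prod_eq_single i (fun j _ hj => if_neg (huniq j hj)) (by simp),
      Finset.sum_eq_single i (fun j _ hj => if_neg (huniq j hj)) (by simp), if_pos hi, if_pos hi,
      mul_one]
  · push Not at h
    rw [Finset.prod_eq_one fun i _ => if_neg fun hi => h i hi.1 hi.2,
      Finset.sum_eq_zero fun i _ => if_neg fun hi => h i hi.1 hi.2, mul_zero, add_zero]

/-- The product of the first `s` weighted one step transition matrices. -/
def weightedProd (U : Matrix I I ℝ) (r : Fin k → Fin T) (q : Fin k → I) (τ : ℝ) (s : ℕ) :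
    Matrix I I ℝ :=
  ((List.range s).map fun t => Matrix.diagonal (pointWeight r q τ t) * U).prod

/-- Expand according to the last marked point at which the term `τ` is picked: all weights are kept
before it, and the evolution after it is unweighted. -/
theorem weightedProd_apply (U : Matrix I I ℝ) {r : Fin k → Fin T} {q : Fin k → I}
    (hinj : Function.Injective fun i => (r i, q i)) (τ : ℝ) (s : ℕ) (x y : I) :
    weightedProd U r q τ s x y = (U ^ s) x y + τ * ∑ i, if (r i : ℕ) < s then
      weightedProd U r q τ (r i) x (q i) * (U ^ (s - r i)) (q i) y else 0 := by
  induction s generalizing y with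
  | zero => simp [weightedProd]
  | succ s ih =>
    have h1 : weightedProd U r q τ (s + 1) x y =
        ∑ z, weightedProd U r q τ s x z * U z y + τ * ∑ i, if (r i : ℕ) = s then
          weightedProd U r q τ s x (q i) * U (q i) y else 0 := by
      rw [weightedProd, List.range_succ, List.map_append, List.prod_append, Matrix.mul_apply]
      simp only [List.map_cons, List.map_nil, List.prod_cons, List.prod_nil, mul_one,
        Matrix.diagonal_mul, pointWeight_eq hinj]
      rw [← weightedProd, Finset.mul_sum]
      have : ∀ i, (if (r i : ℕ) = s then weightedProd U r q τ s x (q i) * U (q i) y else 0) =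
          ∑ z, if (r i : ℕ) = s ∧ q i = z then weightedProd U r q τ s x z * U z y else 0 := by
        intro i
        by_cases hi : (r i : ℕ) = s <;> simp [hi]
      simp_rw [this, Finset.mul_sum]
      rw [Finset.sum_comm, ← Finset.sum_add_distrib]
      refine Finset.sum_congr rfl fun z _ => ?_
      rw [add_mul, one_mul, mul_add, Finset.sum_mul, Finset.mul_sum]
      congr 1
      refine Finset.sum_congr rfl fun i _ => ?_
      split_ifs <;> ring
    rw [h1, Finset.sum_congr rfl fun z _ => congrArg (· * U z y) (ih z)]
    simp_rw [add_mul, Finset.sum_add_distrib]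
    rw [← Matrix.mul_apply, ← pow_succ, add_assoc]
    congr 1
    simp_rw [mul_assoc, ← Finset.mul_sum, ← mul_add, Finset.sum_mul]
    congr 1
    rw [Finset.sum_comm, ← Finset.sum_add_distrib]
    refine Finset.sum_congr rfl fun i _ => ?_
    rcases lt_trichotomy (r i : ℕ) s with h | h | h
    · rw [if_neg h.ne, if_pos (h.trans s.lt_succ_self), add_zero]
      simp_rw [if_pos h, mul_assoc]
      rw [← Finset.mul_sum, ← Matrix.mul_apply, ← pow_succ]
      rw [Nat.succ_sub h.le]
    · have h2 : s + 1 - (r i : ℕ) = 1 := by omega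
      rw [if_pos h, if_pos (h ▸ s.lt_succ_self), h2, pow_one]
      simp [h]
    · have h2 : ¬ (r i : ℕ) < s := by omega
      have h3 : ¬ (r i : ℕ) < s + 1 := by omega
      rw [if_neg h.ne', if_neg h3]
      simp [h2]

/-- The transition weights between points on different lines. -/
def interMatrix (U : Matrix I I ℝ) (r : Fin k → Fin T) (q : Fin k → I) :
    Matrix (Fin k) (Fin k) ℝ :=
  Matrix.of fun i j => if r i < r j then (U ^ ((r j : ℕ) - r i)) (q i) (q j) else 0

/-- `interMatrix` only leads strictly forward in time, so the matrix is block unitriangular. -/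
theorem det_one_sub_smul_interMatrix (U : Matrix I I ℝ) (r : Fin k → Fin T) (q : Fin k → I)
    (τ : ℝ) : (1 - τ • interMatrix U r q).det = 1 := by
  have h : (1 - τ • interMatrix U r q).BlockTriangular r := by
    intro i j hij
    have hne : i ≠ j := fun h => by simp [h] at hij
    simp [interMatrix, Matrix.one_apply_ne hne, not_lt.2 hij.le]
  rw [h.det_fintype]
  refine Finset.prod_eq_one fun t _ => ?_
  have : (1 - τ • interMatrix U r q).toSquareBlock r t = 1 := by
    ext i j
    simp [Matrix.toSquareBlock_def, interMatrix, i.2, j.2, Matrix.one_apply, Subtype.ext_iff]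
  rw [this, Matrix.det_one]

/-- The transition weights from the starting points. -/
def startMatrix {a : ℕ} (U : Matrix I I ℝ) (x : Fin a → I) (r : Fin k → Fin T) (q : Fin k → I) :
    Matrix (Fin a) (Fin k) ℝ :=
  Matrix.of fun j i => (U ^ (r i : ℕ)) (x j) (q i)

/-- The transition weights to the end points. -/
def endMatrix {a : ℕ} (U : Matrix I I ℝ) (y : Fin a → I) (r : Fin k → Fin T) (q : Fin k → I) :
    Matrix (Fin k) (Fin a) ℝ :=
  Matrix.of fun i j => (U ^ (T - r i)) (q i) (y j)

/-- The correlation kernel between the given points. -/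
noncomputable def correlationMatrix {a : ℕ} (U : Matrix I I ℝ) (x y : Fin a → I) (r : Fin k → Fin T)
    (q : Fin k → I) : Matrix (Fin k) (Fin k) ℝ :=
  -interMatrix U r q +
    endMatrix U y r q * ((U ^ T).submatrix x y)⁻¹ * startMatrix U x r q

/-- Let `h` collect the weighted transitions from the starting points to the marked points. The
last-point expansion reads `h (1 - τ W) = u` at the marked points and `G + τ h v` at the end, and
`h` is eliminated between the two. -/
theorem det_weightedProd {a : ℕ} (U : Matrix I I ℝ) (x y : Fin a → I) {r : Fin k → Fin T}
    {q : Fin k → I} (hinj : Function.Injective fun i => (r i, q i))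
    (hG : IsUnit ((U ^ T).submatrix x y).det) (τ : ℝ) :
    ((weightedProd U r q τ T).submatrix x y).det =
      ((U ^ T).submatrix x y).det * (1 + τ • correlationMatrix U x y r q).det := by
  set G := (U ^ T).submatrix x y with hGdef
  set W := interMatrix U r q with hW
  set v := endMatrix U y r q with hv
  set u := startMatrix U x r q with hu
  let h : Matrix (Fin a) (Fin k) ℝ :=
    Matrix.of fun j i => weightedProd U r q τ (r i) (x j) (q i)
  have h1 : (weightedProd U r q τ T).submatrix x y = G + τ • (h * v) := by
    ext j l
    rw [Matrix.submatrix_apply, weightedProd_apply U hinj]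
    simp [hGdef, hv, endMatrix, h, Matrix.mul_apply]
  have h2 : h * (1 - τ • W) = u := by
    rw [Matrix.mul_sub, Matrix.mul_one, sub_eq_iff_eq_add]
    ext j i
    change weightedProd U r q τ (r i) (x j) (q i) = _
    rw [weightedProd_apply U hinj]
    simp only [hu, startMatrix, Matrix.add_apply, Matrix.of_apply, Matrix.mul_smul,
      Matrix.smul_apply, smul_eq_mul, Matrix.mul_apply, hW, interMatrix, mul_ite, mul_zero, h,
      Fin.lt_def]
  have h3 : G + τ • (h * v) = G * (1 + (G⁻¹ * (τ • h)) * v) := by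
    rw [Matrix.mul_add, Matrix.mul_one, ← Matrix.mul_assoc, ← Matrix.mul_assoc,
      Matrix.mul_nonsing_inv _ hG, Matrix.one_mul, Matrix.smul_mul]
  -- Sylvester's identity passes from size `a` to size `k`. Multiplying by `det (1 - τ W) = 1` then
  -- turns `h` into `u`.
  rw [h1, h3, Matrix.det_mul, Matrix.det_one_add_mul_comm]
  congr 1
  rw [← mul_one (Matrix.det _), ← det_one_sub_smul_interMatrix U r q τ, ← Matrix.det_mul, ← hW]
  congr 1
  rw [Matrix.add_mul, Matrix.one_mul, Matrix.mul_assoc, Matrix.mul_assoc, Matrix.smul_mul, h2,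
    correlationMatrix, ← hW, ← hv, ← hu, ← hGdef, smul_add, Matrix.mul_smul, Matrix.mul_smul,
    Matrix.mul_assoc]
  simp only [smul_neg]
  abel

end EynardMehta

/-! ### The Eynard–Mehta theorem for families of paths. -/

section Correlations

variable {I : Type*} [Fintype I] [LinearOrder I] {k T a : ℕ}

theorem minorMatrix_diagonal_mul (d : I → ℝ) (U : Matrix I I ℝ) (x y : Fin a ↪o I) :
    minorMatrix a (Matrix.diagonal d * U) x y = (∏ j, d (x j)) * minorMatrix a U x y := by
  rw [minorMatrix, minorMatrix, Matrix.of_apply, Matrix.of_apply, ← Matrix.det_mul_column]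
  congr 1
  ext i j
  simp [Matrix.diagonal_mul]

omit [Fintype I] in
theorem prod_pointWeight (r : Fin k → Fin T) (q : Fin k → I) (τ : ℝ)
    (p : Fin (T + 1) → Fin a ↪o I) [∀ i, Decidable (∃ j, p (r i).castSucc j = q i)] :
    ∏ t : Fin T, ∏ j, pointWeight r q τ t (p t.castSucc j) =
      ∏ i, if ∃ j, p (r i).castSucc j = q i then 1 + τ else 1 := by
  simp_rw [pointWeight]
  rw [Finset.prod_congr rfl fun t _ => Finset.prod_comm, Finset.prod_comm]
  refine Finset.prod_congr rfl fun i _ => ?_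
  rw [Finset.prod_eq_single (r i) (fun t _ ht => Finset.prod_eq_one fun j _ =>
    if_neg fun h => ht (Fin.ext h.1.symm)) (by simp)]
  split_ifs with h
  · obtain ⟨j, hj⟩ := h
    rw [Finset.prod_eq_single j (fun l _ hl => if_neg fun h => hl
      ((p _).injective (h.2.symm.trans hj.symm))) (by simp)]
    simp [hj]
  · refine Finset.prod_eq_one fun j _ => if_neg fun hj => h ⟨j, hj.2.symm⟩

/-- The weighted count of the families of paths. -/
theorem sum_minor_paths (U : Matrix I I ℝ) (x y : Fin a ↪o I) {r : Fin k → Fin T}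
    {q : Fin k → I} (hinj : Function.Injective fun i => (r i, q i))
    (hG : IsUnit ((U ^ T).submatrix x y).det) (τ : ℝ)
    [∀ (p : Fin (T + 1) → Fin a ↪o I) i, Decidable (∃ j, p (r i).castSucc j = q i)] :
    ∑ p : Fin (T + 1) → Fin a ↪o I, (if p 0 = x ∧ p (Fin.last T) = y then
      ((∏ i, if ∃ j, p (r i).castSucc j = q i then 1 + τ else 1) *
        ∏ t : Fin T, minorMatrix a U (p t.castSucc) (p t.succ)) else 0) =
      ((U ^ T).submatrix x y).det * (1 + τ • correlationMatrix U x y r q).det := by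
  classical
  rw [← det_weightedProd U x y hinj hG τ]
  have h : ((weightedProd U r q τ T).submatrix x y).det =
      minorMatrix a (weightedProd U r q τ T) x y := rfl
  rw [h, weightedProd, minorMatrix_list_prod, List.map_map]
  have := sum_paths_eq_prod T
    (fun t => minorMatrix a (Matrix.diagonal (pointWeight r q τ t) * U)) x y
  refine Eq.trans ?_ this
  refine Finset.sum_congr rfl fun p _ => ?_
  split_ifs
  · simp_rw [minorMatrix_diagonal_mul]
    rw [Finset.prod_mul_distrib, prod_pointWeight]
  · rfl

/-- The **Eynard–Mehta theorem** for products of minors of a single transition matrix. -/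
theorem sum_minor_paths_through (U : Matrix I I ℝ) (x y : Fin a ↪o I) {r : Fin k → Fin T}
    {q : Fin k → I} (hinj : Function.Injective fun i => (r i, q i))
    (hG : IsUnit ((U ^ T).submatrix x y).det)
    [∀ (p : Fin (T + 1) → Fin a ↪o I) i, Decidable (∃ j, p (r i).castSucc j = q i)] :
    ∑ p : Fin (T + 1) → Fin a ↪o I, (if p 0 = x ∧ p (Fin.last T) = y then
      ((∏ i, if ∃ j, p (r i).castSucc j = q i then 1 else 0) *
        ∏ t : Fin T, minorMatrix a U (p t.castSucc) (p t.succ)) else 0) =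
      ((U ^ T).submatrix x y).det * (correlationMatrix U x y r q).det := by
  -- With `ε = τ⁻¹` and both sides multiplied by `ε ^ k`, the identity is polynomial in `ε`. Its
  -- value at `ε = 0`, reached by continuity, is the top coefficient in `τ`.
  let F : ℝ → ℝ := fun ε => ∑ p : Fin (T + 1) → Fin a ↪o I, (if p 0 = x ∧ p (Fin.last T) = y then
      ((∏ i, (ε + if ∃ j, p (r i).castSucc j = q i then 1 else 0)) *
        ∏ t : Fin T, minorMatrix a U (p t.castSucc) (p t.succ)) else 0)
  let H : ℝ → ℝ := fun ε =>
    ((U ^ T).submatrix x y).det *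
      (ε • (1 : Matrix (Fin k) (Fin k) ℝ) + correlationMatrix U x y r q).det
  have hF : Continuous F := by
    refine continuous_finsetSum _ fun p _ => ?_
    split_ifs
    · exact (continuous_finsetProd _ fun i _ => by fun_prop).mul continuous_const
    · exact continuous_const
  have hH : Continuous H := continuous_const.mul
    (Continuous.matrix_det (by fun_prop))
  have hFH : F = H := by
    refine Continuous.ext_on (dense_compl_singleton (0 : ℝ)) hF hH fun ε hε => ?_
    have hε : ε ≠ 0 := hε
    have h1 : F ε = ε ^ k * (((U ^ T).submatrix x y).det *
        (1 + ε⁻¹ • correlationMatrix U x y r q).det) := by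
      rw [← sum_minor_paths U x y hinj hG, Finset.mul_sum]
      refine Finset.sum_congr rfl fun p _ => ?_
      split_ifs
      · rw [← mul_assoc]
        congr 1
        rw [← Fin.prod_const, ← Finset.prod_mul_distrib]
        refine Finset.prod_congr rfl fun i _ => ?_
        split_ifs
        · rw [mul_add, mul_inv_cancel₀ hε, mul_one]
        · ring
      · simp
    have h2 : ε • (1 : Matrix (Fin k) (Fin k) ℝ) + correlationMatrix U x y r q =
        ε • (1 + ε⁻¹ • correlationMatrix U x y r q) := by
      rw [smul_add, smul_smul, mul_inv_cancel₀ hε, one_smul]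
    change F ε = _ * _
    rw [h1, h2, Matrix.det_smul, Fintype.card_fin]
    ring
  have := congrFun hFH 0
  simpa [F, H] using this

end Correlations

/-! ### Falling factorials and binomial coefficients -/

/-- The falling factorial `x (x - 1) ⋯ (x - n + 1)`. -/
noncomputable def ff (x : ℝ) (n : ℕ) : ℝ := (descPochhammer ℝ n).eval x

@[simp] theorem ff_zero (x : ℝ) : ff x 0 = 1 := by simp [ff]

theorem ff_succ (x : ℝ) (n : ℕ) : ff x (n + 1) = ff x n * (x - n) :=
  descPochhammer_succ_eval n x

theorem ff_succ_left (x : ℝ) (n : ℕ) : ff x (n + 1) = x * ff (x - 1) n := by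
  simp [ff, descPochhammer_succ_left]

theorem ff_add (x : ℝ) (m n : ℕ) : ff x (m + n) = ff x m * ff (x - m) n := by
  induction n with
  | zero => simp
  | succ n ih => rw [← add_assoc, ff_succ, ff_succ, ih]; push_cast; ring

theorem ff_sub_split (x : ℝ) {m n : ℕ} (h : m ≤ n) : ff x n = ff x m * ff (x - m) (n - m) := by
  rw [← ff_add, Nat.add_sub_cancel' h]

theorem ff_neg (x : ℝ) (n : ℕ) : ff (-x) n = (-1) ^ n * ff (x + n - 1) n := by
  induction n generalizing x with
  | zero => simp
  | succ n ih =>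
    rw [ff_succ_left, show -x - 1 = -(x + 1) by ring, ih, ff_succ_left]
    push_cast
    have h1 : ff (x + 1 + n - 1) n * x = ff (x + n) (n + 1) := by
      rw [ff_succ, show x + 1 + (n : ℝ) - 1 = x + n by ring]; ring
    have h2 : ff (x + n) (n + 1) = (x + n) * ff (x + n - 1) n := ff_succ_left _ _
    have h3 : x + ((n : ℝ) + 1) - 1 = x + n := by ring
    rw [h3]
    calc -x * ((-1) ^ n * ff (x + 1 + n - 1) n)
        = -(-1) ^ n * (ff (x + 1 + n - 1) n * x) := by ring
      _ = _ := by rw [h1, h2]; ring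

theorem ff_natCast_mul_factorial {m n : ℕ} (h : n ≤ m) :
    ff m n * ((m - n).factorial : ℝ) = m.factorial := by
  rw [ff, descPochhammer_eval_eq_descFactorial, mul_comm]
  exact_mod_cast Nat.factorial_mul_descFactorial h

theorem ff_natCast_of_lt {m n : ℕ} (h : m < n) : ff m n = 0 := by
  rw [ff, descPochhammer_eval_eq_descFactorial]
  exact_mod_cast Nat.descFactorial_of_lt h

theorem poch_neg (x : ℝ) (n : ℕ) : poch (-x) n = (-1) ^ n * ff x n :=
  ascPochhammer_eval_neg_eq_descPochhammer _ x n

/-- A form of the Chu–Vandermonde identity. -/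
theorem sum_choose_ff (n : ℕ) (x y : ℝ) :
    ∑ m ∈ Finset.range (n + 1), (n.choose m : ℝ) * (-1) ^ m * ff x m * ff (y - m) (n - m) =
      ff (y - x) n := by
  induction n generalizing x y with
  | zero => simp
  | succ n ih =>
    rw [Finset.sum_range_succ']
    have h1 : ∀ m ∈ Finset.range (n + 1), ((n + 1).choose (m + 1) : ℝ) * (-1) ^ (m + 1) *
        ff x (m + 1) * ff (y - (m + 1 : ℕ)) (n + 1 - (m + 1)) =
        -x * ((n.choose m : ℝ) * (-1) ^ m * ff (x - 1) m * ff ((y - 1) - m) (n - m)) +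
        (n.choose (m + 1) : ℝ) * (-1) ^ (m + 1) * ff x (m + 1) *
          ff (y - (m + 1 : ℕ)) (n - m) := by
      intro m _
      rw [Nat.add_sub_add_right, Nat.choose_succ_succ, ff_succ_left x]
      push_cast
      rw [show y - 1 - (m : ℝ) = y - (m + 1) by ring]
      ring
    rw [Finset.sum_congr rfl h1, Finset.sum_add_distrib, ← Finset.mul_sum, ih, add_assoc]
    have h2 : ∑ m ∈ Finset.range (n + 1), (n.choose (m + 1) : ℝ) * (-1) ^ (m + 1) * ff x (m + 1) *
          ff (y - (m + 1 : ℕ)) (n - m) + ((n + 1).choose 0 : ℝ) * (-1) ^ 0 * ff x 0 *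
          ff (y - (0 : ℕ)) (n + 1 - 0) =
        (y - n) * ∑ m ∈ Finset.range (n + 1),
          (n.choose m : ℝ) * (-1) ^ m * ff x m * ff (y - m) (n - m) := by
      have h3 : ∀ m ∈ Finset.range (n + 1), (y - n) *
          ((n.choose m : ℝ) * (-1) ^ m * ff x m * ff (y - m) (n - m)) =
          (n.choose m : ℝ) * (-1) ^ m * ff x m * ff (y - m) (n + 1 - m) := by
        intro m hm
        have hm : m ≤ n := Nat.lt_succ_iff.1 (Finset.mem_range.1 hm)
        rw [Nat.succ_sub hm, ff_succ, Nat.cast_sub hm]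
        ring
      rw [Finset.mul_sum, Finset.sum_congr rfl h3, Finset.sum_range_succ, Finset.sum_range_succ' _ n]
      simp
    rw [h2, ih, ff_succ, show y - 1 - (x - 1) = y - x by ring]
    ring

/-- The binomial coefficient with an integer lower entry. -/
def intChoose (n : ℕ) (k : ℤ) : ℝ := if 0 ≤ k then (n.choose k.toNat : ℝ) else 0

theorem intChoose_natCast (n k : ℕ) : intChoose n k = n.choose k := by simp [intChoose]

theorem intChoose_of_neg (n : ℕ) {k : ℤ} (h : k < 0) : intChoose n k = 0 := if_neg (not_le.2 h)

theorem intChoose_of_lt (n : ℕ) {k : ℤ} (h : n < k) : intChoose n k = 0 := by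
  rw [intChoose, if_pos (by omega), Nat.choose_eq_zero_of_lt (by omega), Nat.cast_zero]

theorem intChoose_symm (n : ℕ) (k : ℤ) : intChoose n (n - k) = intChoose n k := by
  rcases lt_or_ge k 0 with h | h
  · rw [intChoose_of_neg n h, intChoose_of_lt n (by omega)]
  · lift k to ℕ using h
    rcases le_or_gt k n with hk | hk
    · rw [← Nat.cast_sub hk, intChoose_natCast, intChoose_natCast, Nat.choose_symm hk]
    · rw [intChoose_of_lt n (by omega : (n : ℤ) < k), intChoose_of_neg n (by omega)]

/-- Vandermonde's convolution. `S` need only contain the support of the summand, so the same form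
serves windows and intervals. -/
theorem sum_intChoose_mul (m n : ℕ) (p q : ℤ) (S : Finset ℤ)
    (hS : ∀ i, p ≤ i → i ≤ p + m → i ≤ q → i ∈ S) :
    ∑ i ∈ S, intChoose m (i - p) * intChoose n (q - i) = intChoose (m + n) (q - p) := by
  have h1 : ∑ i ∈ S, intChoose m (i - p) * intChoose n (q - i) =
      ∑ i ∈ Finset.Icc p q, intChoose m (i - p) * intChoose n (q - i) := by
    refine (Finset.sum_subset (Finset.subset_union_left : S ⊆ S ∪ Finset.Icc p q) ?_).trans
      (Finset.sum_subset Finset.subset_union_right ?_).symm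
    rotate_left
    · intro i _ hi
      rw [Finset.mem_Icc, not_and_or, not_le, not_le] at hi
      rcases hi with hi | hi
      · rw [intChoose_of_neg m (by omega), zero_mul]
      · rw [intChoose_of_neg n (by omega), mul_zero]
    · intro i _ hi
      by_cases h1 : p ≤ i
      · by_cases h2 : i ≤ p + m
        · by_cases h3 : i ≤ q
          · exact absurd (hS i h1 h2 h3) hi
          · rw [intChoose_of_neg n (by omega), mul_zero]
        · rw [intChoose_of_lt m (by omega), zero_mul]
      · rw [intChoose_of_neg m (by omega), zero_mul]
  rw [h1]
  rcases lt_or_ge q p with hqp | hqp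
  · rw [Finset.Icc_eq_empty (by omega), intChoose_of_neg _ (by omega), Finset.sum_empty]
  · obtain ⟨k, rfl⟩ : ∃ k : ℕ, q = p + k := ⟨(q - p).toNat, by omega⟩
    rw [add_sub_cancel_left, intChoose_natCast, Nat.add_choose_eq,
      Finset.Nat.sum_antidiagonal_eq_sum_range_succ fun i j => m.choose i * n.choose j]
    push_cast
    symm
    refine Finset.sum_nbij (fun i : ℕ => p + i) ?_ ?_ ?_ ?_
    · intro i hi
      have := Finset.mem_range.1 hi
      simp only [Finset.mem_Icc]; omega
    · intro i _ j _ h; simpa using h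
    · intro i hi
      have := Finset.mem_Icc.1 (Finset.mem_coe.1 hi)
      refine ⟨(i - p).toNat, ?_, ?_⟩
      · simp only [Finset.coe_range, Set.mem_Iio]; omega
      · simp only; omega
    · intro i hi
      have := Finset.mem_range.1 hi
      rw [add_sub_cancel_left, show p + (k : ℤ) - (p + i) = ((k - i : ℕ) : ℤ) by omega,
        intChoose_natCast, intChoose_natCast]

/-! ### The hypergeometric sums -/

/-- The terminating `₃F₂` sum which defines the Hahn polynomials. -/
noncomputable def hahnSum (n : ℕ) (E x A R : ℝ) : ℝ :=
  ∑ j ∈ Finset.range (n + 1), (n.choose j : ℝ) * (-1) ^ j * ff E j * ff x j *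
    ff (A - j) (n - j) * ff (R - j) (n - j)

/-- A terminating case of the Thomae–Sheppard transformation. -/
theorem hahnSum_reflect (n : ℕ) (E x A B R : ℝ) (h : A + B = E + n - 1) :
    hahnSum n E x A R = (-1) ^ n * hahnSum n E (R - x) B R := by
  have h1 : ∀ j ∈ Finset.range (n + 1), (n.choose j : ℝ) * (-1) ^ j * ff E j * ff x j *
      ff (A - j) (n - j) * ff (R - j) (n - j) =
      ∑ k ∈ Finset.range (n + 1), (n.choose j : ℝ) * (j.choose k : ℝ) * (-1) ^ j * (-1) ^ k *
        ff E j * ff (R - x) k * ff (A - j) (n - j) * ff (R - k) (n - k) := by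
    intro j hj
    have hj : j ≤ n := Nat.lt_succ_iff.1 (Finset.mem_range.1 hj)
    -- Chu–Vandermonde expands `ff x j` in falling factorials of `R - x`; the sum over `j` can then
    -- be done for fixed `k`.
    have h2 : ff x j * ff (R - j) (n - j) = ∑ k ∈ Finset.range (n + 1),
        (j.choose k : ℝ) * (-1) ^ k * ff (R - x) k * ff (R - k) (n - k) := by
      rw [← Finset.sum_subset (Finset.range_subset_range.2 (Nat.succ_le_succ hj))]
      · conv_lhs => rw [show x = R - (R - x) by ring, ← sum_choose_ff, Finset.sum_mul]
        refine Finset.sum_congr rfl fun k hk => ?_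
        have hk : k ≤ j := Nat.lt_succ_iff.1 (Finset.mem_range.1 hk)
        rw [ff_sub_split (R - k) (Nat.sub_le_sub_right hj k : j - k ≤ n - k),
          show n - k - (j - k) = n - j by omega,
          show R - (k : ℝ) - ((j - k : ℕ) : ℝ) = R - j by rw [Nat.cast_sub hk]; ring]
        ring
      · intro k _ hk
        rw [Nat.choose_eq_zero_of_lt (by simpa using hk)]
        simp
    calc _ = (n.choose j : ℝ) * (-1) ^ j * ff E j * ff (A - j) (n - j) *
          (ff x j * ff (R - j) (n - j)) := by ring
      _ = _ := by
        rw [h2, Finset.mul_sum]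
        exact Finset.sum_congr rfl fun k _ => by ring
  rw [hahnSum, Finset.sum_congr rfl h1, Finset.sum_comm, hahnSum, Finset.mul_sum]
  refine Finset.sum_congr rfl fun k hk => ?_
  have hk : k ≤ n := Nat.lt_succ_iff.1 (Finset.mem_range.1 hk)
  have h3 : ∑ j ∈ Finset.range (n + 1), (n.choose j : ℝ) * (j.choose k : ℝ) * (-1) ^ j *
      ff E j * ff (A - j) (n - j) =
      (n.choose k : ℝ) * (-1) ^ k * ff E k * ff (A - E) (n - k) := by
    rw [show n + 1 = k + (n - k + 1) by omega, Finset.sum_range_add, Finset.sum_eq_zero, zero_add,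
      show A - E = (A - k) - (E - k) by ring, ← sum_choose_ff, Finset.mul_sum]
    · refine Finset.sum_congr rfl fun m hm => ?_
      have hm : m ≤ n - k := Nat.lt_succ_iff.1 (Finset.mem_range.1 hm)
      rw [ff_add, show n - (k + m) = n - k - m by omega, pow_add]
      have h4 : (n.choose (k + m) : ℝ) * ((k + m).choose k : ℝ) =
          (n.choose k : ℝ) * ((n - k).choose m : ℝ) := by
        have := Nat.choose_mul (n := n) (k := k + m) (s := k) (by omega)
        rw [Nat.add_sub_cancel_left] at this
        exact_mod_cast this
      rw [h4]
      push_cast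
      rw [show A - ((k : ℝ) + m) = A - k - m by ring]
      ring
    · intro j hj
      rw [Nat.choose_eq_zero_of_lt (Finset.mem_range.1 hj)]
      simp
  -- The balancing condition on `A + B` enters here: it turns `A - E` into the reflected parameter
  -- `B`.
  have h5 : ff (A - E) (n - k) = (-1) ^ (n - k) * ff (B - k) (n - k) := by
    rw [show A - E = -(E - A) by ring, ff_neg]
    congr 2
    rw [Nat.cast_sub hk]
    linarith
  have h6 : (-1 : ℝ) ^ (n - k) * (-1) ^ k = (-1) ^ n := by rw [← pow_add, Nat.sub_add_cancel hk]
  calc _ = (∑ j ∈ Finset.range (n + 1), (n.choose j : ℝ) * (j.choose k : ℝ) * (-1) ^ j *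
      ff E j * ff (A - j) (n - j)) * ((-1) ^ k * ff (R - x) k * ff (R - k) (n - k)) := by
        rw [Finset.sum_mul]
        exact Finset.sum_congr rfl fun j _ => by ring
    _ = _ := by
      rw [h3, h5, ← h6]
      ring

theorem hahnSum_comm (n : ℕ) (E x A R : ℝ) : hahnSum n E x A R = hahnSum n E x R A :=
  Finset.sum_congr rfl fun j _ => by ring

/-- Reflect twice, exchanging the symmetric roles of `A` and `R` in between. The argument goes `x ↦
R - x ↦ B - (R - x)` and the two signs cancel. -/
theorem hahnSum_transform (n : ℕ) (E x A B R R' : ℝ) (h : A + B = E + n - 1)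
    (h' : R + R' = E + n - 1) : hahnSum n E x A R = hahnSum n E (x + B - R) B R' := by
  rw [hahnSum_reflect n E x A B R h, hahnSum_comm, hahnSum_reflect n E (R - x) R R' B h',
    ← mul_assoc, ← pow_add, ← two_mul, pow_mul]
  rw [hahnSum_comm]
  norm_num
  congr 1
  ring

/-! ### Biorthogonal functions -/

/-- The weights `ω̃` times Hahn polynomials, in a form which makes the evolution transparent. -/
noncomputable def hahnFun (n : ℕ) (E A : ℝ) (R : ℕ) (i : ℤ) : ℝ :=
  ∑ m ∈ Finset.range (n + 1), (n.choose m : ℝ) * (-1) ^ m * ff E m * ff (A - m) (n - m) *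
    intChoose (R - m) (i - m)

theorem hahnFun_evolve (n : ℕ) (E A : ℝ) {R : ℕ} (hn : n ≤ R) (s : ℕ) (i : ℤ) (S : Finset ℤ)
    (hS : ∀ k : ℤ, 0 ≤ k → k ≤ R → k ≤ i → k ∈ S) :
    ∑ k ∈ S, hahnFun n E A R k * intChoose s (i - k) = hahnFun n E A (R + s) i := by
  unfold hahnFun
  simp_rw [Finset.sum_mul]
  rw [Finset.sum_comm]
  refine Finset.sum_congr rfl fun m hm => ?_
  have hm : m ≤ n := Nat.lt_succ_iff.1 (Finset.mem_range.1 hm)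
  simp_rw [mul_assoc _ (intChoose (R - m) _)]
  rw [← Finset.mul_sum, sum_intChoose_mul _ _ _ _ _ fun k h1 h2 h3 => hS k ?_ ?_ h3]
  · rw [show R - m + s = R + s - m by omega]
  · omega
  · omega

/-- The pairing of the coefficients of two Hahn polynomials. -/
noncomputable def hahnPairing (D n m : ℕ) : ℝ :=
  ∑ p ∈ Finset.range (n + 1), ∑ q ∈ Finset.range (m + 1),
    ((n.choose p : ℝ) * (-1) ^ p * ff ((D : ℝ) + 1 - n) p) *
    ((m.choose q : ℝ) * (-1) ^ q * ff ((D : ℝ) + 1 - m) q) * ((D - p - q).factorial : ℝ)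

theorem hahnPairing_comm (D n m : ℕ) : hahnPairing D n m = hahnPairing D m n := by
  rw [hahnPairing, Finset.sum_comm, hahnPairing]
  refine Finset.sum_congr rfl fun p _ => ?_
  refine Finset.sum_congr rfl fun q _ => ?_
  rw [Nat.sub_right_comm]
  ring

/-- The sum over `q` is Chu–Vandermonde at `D + 1 - m` and `D - p`, once `(D - p - q)!` is split as
a falling factorial times `(D - p - m)!`. -/
theorem hahnPairing_eq_sum (D n m : ℕ) (h : n + m ≤ D) : hahnPairing D n m =
    ∑ p ∈ Finset.range (n + 1), ((n.choose p : ℝ) * (-1) ^ p * ff ((D : ℝ) + 1 - n) p) *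
      ((D - p - m).factorial : ℝ) * ff ((m : ℝ) - 1 - p) m := by
  unfold hahnPairing
  refine Finset.sum_congr rfl fun p hp => ?_
  have hp : p ≤ n := Nat.lt_succ_iff.1 (Finset.mem_range.1 hp)
  rw [show (m : ℝ) - 1 - p = ((D : ℝ) - p) - (D + 1 - m) by ring,
    ← sum_choose_ff m, Finset.mul_sum]
  refine Finset.sum_congr rfl fun q hq => ?_
  have hq : q ≤ m := Nat.lt_succ_iff.1 (Finset.mem_range.1 hq)
  have h1 := ff_natCast_mul_factorial (m := D - p - q) (n := m - q) (by omega)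
  rw [show D - p - q - (m - q) = D - p - m by omega, Nat.cast_sub (by omega),
    Nat.cast_sub (by omega)] at h1
  rw [← h1]
  ring

/-- Every `p ≤ n < m` makes `m - 1 - p` a natural number below `m`, so its falling factorial of
length `m` vanishes. -/
theorem hahnPairing_of_lt (D : ℕ) {n m : ℕ} (h : n + m ≤ D) (hlt : n < m) :
    hahnPairing D n m = 0 := by
  rw [hahnPairing_eq_sum D n m h]
  refine Finset.sum_eq_zero fun p hp => ?_
  have hp : p ≤ n := Nat.lt_succ_iff.1 (Finset.mem_range.1 hp)
  have h1 : (m : ℝ) - 1 - p = ((m - 1 - p : ℕ) : ℝ) := by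
    rw [Nat.cast_sub (by omega), Nat.cast_sub (by omega), Nat.cast_one]
  rw [h1, ff_natCast_of_lt (by omega), mul_zero]

/-- Only the term `p = n` survives; there the falling factorial is `ff (-1) n`. -/
theorem hahnPairing_self (D n : ℕ) (h : n + n ≤ D) :
    hahnPairing D n n = n.factorial * ((D + 1 - n).factorial : ℝ) / ((D : ℝ) + 1 - 2 * n) := by
  rw [hahnPairing_eq_sum D n n h, Finset.sum_range_succ, Finset.sum_eq_zero, zero_add]
  · have h1 : ff ((n : ℝ) - 1 - n) n = (-1) ^ n * n.factorial := by
      rw [show (n : ℝ) - 1 - n = -1 by ring, ff_neg, show (1 : ℝ) + n - 1 = n by ring]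
      have := ff_natCast_mul_factorial (le_refl n)
      simp only [Nat.sub_self, Nat.factorial_zero, Nat.cast_one, mul_one] at this
      rw [this]
    have h2 := ff_natCast_mul_factorial (m := D + 1 - n) (n := n) (by omega)
    rw [show D + 1 - n - n = (D - n - n) + 1 by omega, Nat.factorial_succ,
      Nat.cast_sub (by omega)] at h2
    push_cast at h2
    rw [Nat.cast_sub (by omega), Nat.cast_sub (by omega)] at h2
    have h3 : (D : ℝ) + 1 - 2 * n ≠ 0 := by
      have : ((n + n : ℕ) : ℝ) ≤ D := Nat.cast_le.2 h
      push_cast at this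
      linarith
    have h4 : ((-1 : ℝ) ^ n) * (-1) ^ n = 1 := by rw [← mul_pow]; norm_num
    rw [h1, eq_div_iff h3, ← h2, Nat.choose_self]
    push_cast
    linear_combination (ff ((D : ℝ) + 1 - n) n * ((D - n - n).factorial : ℝ) * n.factorial *
      (D + 1 - 2 * n)) * h4
  · intro p hp
    have hp : p < n := Finset.mem_range.1 hp
    have h1 : (n : ℝ) - 1 - p = ((n - 1 - p : ℕ) : ℝ) := by
      rw [Nat.cast_sub (by omega), Nat.cast_sub (by omega), Nat.cast_one]
    rw [h1, ff_natCast_of_lt (by omega), mul_zero]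

theorem hahnPairing_of_ne (D : ℕ) {n m : ℕ} (h : n + m ≤ D) (hne : n ≠ m) :
    hahnPairing D n m = 0 := by
  rcases hne.lt_or_gt with hlt | hlt
  · exact hahnPairing_of_lt D h hlt
  · rw [hahnPairing_comm]; exact hahnPairing_of_lt D (by omega) hlt

/-- Since `R + R' = A + B`, symmetry of binomials rewrites the second factor as `binom(R' - q, A -
i)`. Vandermonde then gives `binom(A + B - p - q, A - p)`, free of `R`, and the remaining falling
factorials cancel its denominators. -/
theorem sum_hahnFun_mul_hahnFun {n m A B R R' : ℕ} (hnA : n ≤ A) (hmB : m ≤ B) (hn : n ≤ R)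
    (hm : m ≤ R') (h : R + R' = A + B) (S : Finset ℤ)
    (hS : ∀ k : ℤ, 0 ≤ k → k ≤ R → k ≤ A → k ∈ S) :
    ∑ i ∈ S, hahnFun n ((A + B : ℕ) + 1 - n : ℝ) A R i *
      hahnFun m ((A + B : ℕ) + 1 - m : ℝ) B R' (i + B - R) =
      hahnPairing (A + B) n m / ((A - n).factorial * (B - m).factorial) := by
  unfold hahnFun hahnPairing
  simp_rw [Finset.sum_mul_sum]
  rw [Finset.sum_comm, Finset.sum_div]
  refine Finset.sum_congr rfl fun p hp => ?_
  have hp : p ≤ n := Nat.lt_succ_iff.1 (Finset.mem_range.1 hp)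
  rw [Finset.sum_comm, Finset.sum_div]
  refine Finset.sum_congr rfl fun q hq => ?_
  have hq : q ≤ m := Nat.lt_succ_iff.1 (Finset.mem_range.1 hq)
  have h1 : ∀ i : ℤ, intChoose (R' - q) (i + B - R - q) = intChoose (R' - q) (A - i) := by
    intro i
    rw [← intChoose_symm]
    congr 1
    omega
  simp_rw [h1, mul_mul_mul_comm _ (intChoose _ _)]
  rw [← Finset.mul_sum, sum_intChoose_mul _ _ _ _ _ fun k h1 h2 h3 => hS k (by omega) (by omega) h3,
    show (A : ℤ) - p = ((A - p : ℕ) : ℤ) by omega, intChoose_natCast,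
    show R - p + (R' - q) = A + B - p - q by omega]
  have h2 : ((A + B - p - q).choose (A - p) : ℝ) * (A - p).factorial * (B - q).factorial =
      (A + B - p - q).factorial := by
    have := Nat.choose_mul_factorial_mul_factorial (n := A + B - p - q) (k := A - p) (by omega)
    rw [show A + B - p - q - (A - p) = B - q by omega] at this
    exact_mod_cast this
  have h3 := ff_natCast_mul_factorial (m := A - p) (n := n - p) (by omega)
  have h4 := ff_natCast_mul_factorial (m := B - q) (n := m - q) (by omega)
  rw [show A - p - (n - p) = A - n by omega] at h3
  rw [show B - q - (m - q) = B - m by omega] at h4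
  rw [← h2, ← h3, ← h4, Nat.cast_sub (hp.trans hnA), Nat.cast_sub (hq.trans hmB)]
  have h5 : ((A - n).factorial : ℝ) ≠ 0 := Nat.cast_ne_zero.2 (Nat.factorial_ne_zero _)
  have h6 : ((B - m).factorial : ℝ) ≠ 0 := Nat.cast_ne_zero.2 (Nat.factorial_ne_zero _)
  rw [eq_div_iff (mul_ne_zero h5 h6)]
  ring

/-! ### Hahn polynomials as hypergeometric sums -/

theorem invFact_natCast (n : ℕ) : invFact n = 1 / (n.factorial : ℝ) := by simp [invFact]

theorem invFact_of_neg {m : ℤ} (h : m < 0) : invFact m = 0 := if_neg (not_le.2 h)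

theorem factorial_cast_ne_zero (n : ℕ) : (n.factorial : ℝ) ≠ 0 :=
  Nat.cast_ne_zero.2 n.factorial_ne_zero

theorem poch_add (x : ℝ) (m n : ℕ) : poch x (m + n) = poch x m * poch (x + m) n := by
  rw [poch, ← ascPochhammer_mul]
  simp [poch]

theorem ff_natCast_ne_zero {m n : ℕ} (h : n ≤ m) : ff m n ≠ 0 := fun h0 => by
  have := ff_natCast_mul_factorial h
  rw [h0, zero_mul] at this
  exact factorial_cast_ne_zero m this.symm

theorem poch_neg_div {M j n : ℕ} (hj : j ≤ n) (hn : n ≤ M) :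
    poch (-(M : ℝ)) n / poch (-(M : ℝ)) j = (-1) ^ (n - j) * ff ((M : ℝ) - j) (n - j) := by
  have h0 : poch (-(M : ℝ)) j ≠ 0 := by
    rw [poch_neg]
    exact mul_ne_zero (pow_ne_zero _ (by norm_num)) (ff_natCast_ne_zero (hj.trans hn))
  rw [div_eq_iff h0, ← poch_neg, show n = j + (n - j) by omega, poch_add, Nat.add_sub_cancel_left,
    show -((M : ℝ) - j) = -M + j by ring]
  ring

/-- The Pochhammer prefactors absorb the denominators of the series, leaving a sum without division
in which the parameters can be transformed freely. -/
theorem hahnPoly_eq_hahnSum (α β : ℕ) {N n : ℕ} (hn : n ≤ N) (x : ℝ) :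
    hahnPoly α β N n x =
      hahnSum n ((2 * N + α + β + 1 : ℕ) - n) x ((N + β : ℕ) : ℝ) N /
        (Real.sqrt (hahnNormSq α β N n) * n.factorial) := by
  rw [hahnPoly, hahnSum, div_mul_eq_mul_div, Finset.mul_sum]
  congr 1
  refine Finset.sum_congr rfl fun j hj => ?_
  have hj : j ≤ n := Nat.lt_succ_iff.1 (Finset.mem_range.1 hj)
  have h1 := poch_neg_div (M := N + β) hj (by omega)
  have h2 := poch_neg_div hj hn
  rw [show -(N : ℝ) - β = -((N + β : ℕ) : ℝ) by push_cast; ring,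
    show (n : ℝ) - 2 * N - α - β - 1 = -(((2 * N + α + β + 1 : ℕ) : ℝ) - n) by push_cast; ring,
    poch_neg x, poch_neg (((2 * N + α + β + 1 : ℕ) : ℝ) - n)]
  have h3 : ((-1 : ℝ)) ^ j * (-1) ^ j = 1 := by rw [← mul_pow]; norm_num
  have h4 : ((-1 : ℝ)) ^ (n - j) * (-1) ^ (n - j) = 1 := by rw [← mul_pow]; norm_num
  calc _ = (poch (-((N + β : ℕ) : ℝ)) n / poch (-((N + β : ℕ) : ℝ)) j) *
        (poch (-(N : ℝ)) n / poch (-(N : ℝ)) j) * (n.choose j : ℝ) * (-1) ^ j *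
        (((-1) ^ j * (-1) ^ j) * (ff x j * ff (((2 * N + α + β + 1 : ℕ) : ℝ) - n) j)) := by ring
    _ = ((-1) ^ (n - j) * (-1) ^ (n - j)) * (ff (((N + β : ℕ) : ℝ) - j) (n - j) *
        ff ((N : ℝ) - j) (n - j) * (n.choose j : ℝ) * (-1) ^ j *
        (((-1) ^ j * (-1) ^ j) * (ff x j * ff (((2 * N + α + β + 1 : ℕ) : ℝ) - n) j))) := by
        rw [h1, h2]; ring
    _ = _ := by rw [h3, h4]; ring

theorem hahnNormSq_eq (α β : ℕ) {N n : ℕ} (hn : n ≤ N) :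
    hahnNormSq α β N n = ((2 * N + α + β + 1 - n).factorial : ℝ) /
      ((((2 * N + α + β + 1 : ℕ) : ℝ) - 2 * n) * n.factorial * (α + β + N - n).factorial *
        (β + N - n).factorial * (α + N - n).factorial * (N - n).factorial) := by
  have h1 : poch ((α : ℝ) + β + N + 1 - n) (N + 1) * (α + β + N - n).factorial =
      (2 * N + α + β + 1 - n).factorial := by
    have h2 : (α : ℝ) + β + N + 1 - n = ((α + β + N - n + 1 : ℕ) : ℝ) := by
      push_cast [Nat.cast_sub (show n ≤ α + β + N by omega)]; ring
    rw [h2, poch, ← ascPochhammer_eval_cast, ascPochhammer_nat_eq_ascFactorial, mul_comm,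
      ← Nat.cast_mul, Nat.factorial_mul_ascFactorial]
    congr 2
    omega
  rw [hahnNormSq, ← h1, show (β : ℤ) + N - n = ((β + N - n : ℕ) : ℤ) by omega,
    show (α : ℤ) + N - n = ((α + N - n : ℕ) : ℤ) by omega,
    show (N : ℤ) - n = ((N - n : ℕ) : ℤ) by omega, invFact_natCast, invFact_natCast,
    invFact_natCast, invFact_natCast]
  have h3 : ((2 * N + α + β + 1 : ℕ) : ℝ) - 2 * n = (α : ℝ) + β + 2 * N + 1 - 2 * n := by
    push_cast; ring
  rw [h3]
  have := factorial_cast_ne_zero (α + β + N - n)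
  field_simp

theorem ff_mul_invFact (i : ℤ) (m : ℕ) : ff i m * invFact i = invFact (i - m) := by
  rcases lt_or_ge i 0 with h | h
  · rw [invFact_of_neg h, invFact_of_neg (by omega), mul_zero]
  · lift i to ℕ using h
    rw [Int.cast_natCast]
    rcases le_or_gt m i with hm | hm
    · rw [← Nat.cast_sub hm, invFact_natCast, invFact_natCast, ← ff_natCast_mul_factorial hm]
      have := factorial_cast_ne_zero (i - m)
      have := ff_natCast_ne_zero hm
      field_simp
    · rw [ff_natCast_of_lt hm, invFact_of_neg (by omega : (i : ℤ) - m < 0), zero_mul]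

theorem factorial_mul_invFact_mul_invFact (n : ℕ) (k : ℤ) :
    (n.factorial : ℝ) * invFact k * invFact (n - k) = intChoose n k := by
  rcases lt_or_ge k 0 with h | h
  · rw [invFact_of_neg h, intChoose_of_neg _ h, mul_zero, zero_mul]
  · lift k to ℕ using h
    rcases le_or_gt k n with hk | hk
    · rw [← Nat.cast_sub hk, invFact_natCast, invFact_natCast, intChoose_natCast,
        Nat.cast_choose ℝ hk]
      have := factorial_cast_ne_zero k
      field_simp
    · rw [intChoose_of_lt _ (by omega), invFact_of_neg (by omega : (n : ℤ) - k < 0), mul_zero]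

/-- In each binomial, `1 / (i - m)!` is `ff i m / i!` and `(R - m)!` is a falling factorial times
`(R - n)!`. The weight `1 / (i! (R - i)!)` therefore factors out of every term. -/
theorem hahnFun_eq_hahnSum (E A : ℝ) {n R : ℕ} (hn : n ≤ R) (i : ℤ) :
    hahnFun n E A R i =
      hahnSum n E i A R * (R - n).factorial * (invFact i * invFact (R - i)) := by
  rw [hahnSum, Finset.sum_mul, Finset.sum_mul]
  refine Finset.sum_congr rfl fun m hm => ?_
  have hm : m ≤ n := Nat.lt_succ_iff.1 (Finset.mem_range.1 hm)
  have h1 := ff_natCast_mul_factorial (m := R - m) (n := n - m) (by omega)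
  rw [show R - m - (n - m) = R - n by omega, Nat.cast_sub (hm.trans hn)] at h1
  rw [← factorial_mul_invFact_mul_invFact, ← h1, ← ff_mul_invFact,
    show ((R - m : ℕ) : ℤ) - (i - m) = R - i by omega]
  ring

/-! ### The Hahn kernel -/

/-- The number of upward steps which leads to the Hahn coordinate `x` at time `r`. -/
def upCoord (b r : ℕ) (x : ℤ) : ℤ := if r ≤ b then x else x + r - b

theorem alphaPar_add (b r : ℕ) (x : ℤ) : alphaPar b r + 2 * x = -r + 2 * upCoord b r x := by
  unfold alphaPar upCoord
  split_ifs <;> omega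

theorem upCoord_injective (b r : ℕ) : Function.Injective (upCoord b r) := fun x y h => by
  unfold upCoord at h
  split_ifs at h <;> omega

theorem transition_eq (b r s : ℕ) (x y : ℤ) :
    transition r s (alphaPar b r + 2 * x) (alphaPar b s + 2 * y) =
      if r < s then intChoose (s - r) (upCoord b s y - upCoord b r x) else 0 := by
  rw [alphaPar_add, alphaPar_add, transition]
  have h : -(s : ℤ) + 2 * upCoord b s y - (-r + 2 * upCoord b r x) + s - r =
      2 * (upCoord b s y - upCoord b r x) := by ring
  rw [h, intChoose, Int.mul_ediv_cancel_left _ two_ne_zero]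
  by_cases hrs : r < s
  · by_cases h0 : 0 ≤ upCoord b s y - upCoord b r x
    · rw [if_pos ⟨hrs, dvd_mul_right _ _, by omega⟩, if_pos hrs, if_pos h0]
    · rw [if_neg (fun h => h0 (by omega)), if_pos hrs, if_neg h0]
  · rw [if_neg (fun h => hrs h.1), if_neg hrs]

section Kernel

variable {a b c : ℕ}

/-- In the coordinate `upCoord` the three cases of the weight become one formula. -/
theorem omegaTildePar_eq {s : ℕ} (hs : s < b + c) (ha : 0 < a) (y : ℤ) :
    omegaTildePar a b c s y =
      invFact (upCoord b s y) * invFact ((s + a - 1 : ℕ) - upCoord b s y) := by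
  unfold omegaTildePar upCoord bPar aPar gammaPar
  split_ifs <;> congr 2 <;> omega

theorem omegaPar_eq (hbc : b ≤ c) {r : ℕ} (hr : r < b + c) (ha : 0 < a) (x : ℤ) :
    omegaPar a b c r x =
      invFact (upCoord b r x + (a + b - 1 : ℕ) - (r + a - 1 : ℕ)) *
        invFact ((a + b + c - 1 - r : ℕ) -
          (upCoord b r x + (a + b - 1 : ℕ) - (r + a - 1 : ℕ))) := by
  unfold omegaPar upCoord bPar aPar gammaPar
  split_ifs <;> congr 2 <;> omega

/-- Passing from one time range to another only permutes the four factorials in the denominator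
besides `n!`, so the norm has one formula for all times. -/
theorem hahnNormSq_par (hbc : b ≤ c) {r n : ℕ} (hr : r < b + c) (hn : n < a) :
    hahnNormSq (bPar b r) (aPar c r) (gammaPar a b c r) n =
      ((2 * a + b + c - 1 - n).factorial : ℝ) /
      (((2 * a + b + c - 1 : ℕ) - 2 * n) * n.factorial * (a + c - 1 - n).factorial *
        (a + b - 1 - n).factorial * (r + a - 1 - n).factorial *
        (a + b + c - 1 - r - n).factorial) := by
  have hγ : n ≤ gammaPar a b c r := by
    unfold gammaPar; split_ifs <;> omega
  have hD : 2 * gammaPar a b c r + bPar b r + aPar c r + 1 = 2 * a + b + c - 1 := by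
    unfold gammaPar aPar bPar; split_ifs <;> omega
  rw [hahnNormSq_eq _ _ hγ, hD]
  by_cases h : r ≤ b
  · have h1 : bPar b r + aPar c r + gammaPar a b c r = a + b + c - 1 - r := by
      unfold gammaPar aPar bPar; split_ifs; omega
    have h2 : aPar c r + gammaPar a b c r = a + c - 1 := by
      unfold gammaPar aPar; split_ifs; omega
    have h3 : bPar b r + gammaPar a b c r = a + b - 1 := by
      unfold gammaPar bPar; split_ifs; omega
    have h4 : gammaPar a b c r = r + a - 1 := by unfold gammaPar; split_ifs; omega
    rw [h1, h2, h3, h4]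
    congr 1
    ring
  · by_cases h' : r ≤ c
    · have h1 : bPar b r + aPar c r + gammaPar a b c r = a + c - 1 := by
        unfold gammaPar aPar bPar; split_ifs; omega
      have h2 : aPar c r + gammaPar a b c r = a + b + c - 1 - r := by
        unfold gammaPar aPar; split_ifs; omega
      have h3 : bPar b r + gammaPar a b c r = r + a - 1 := by
        unfold gammaPar bPar; split_ifs; omega
      have h4 : gammaPar a b c r = a + b - 1 := by unfold gammaPar; split_ifs; omega
      rw [h1, h2, h3, h4]
      congr 1
      ring
    · have h1 : bPar b r + aPar c r + gammaPar a b c r = r + a - 1 := by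
        unfold gammaPar aPar bPar; split_ifs; omega
      have h2 : aPar c r + gammaPar a b c r = a + b - 1 := by
        unfold gammaPar aPar; split_ifs; omega
      have h3 : bPar b r + gammaPar a b c r = a + c - 1 := by
        unfold gammaPar bPar; split_ifs; omega
      have h4 : gammaPar a b c r = a + b + c - 1 - r := by unfold gammaPar; split_ifs; omega
      rw [h1, h2, h3, h4]
      congr 1
      ring

theorem hahnPoly_par (hbc : b ≤ c) {r n : ℕ} (hr : r < b + c) (hn : n < a) (x : ℤ) :
    hahnPoly (bPar b r) (aPar c r) (gammaPar a b c r) n x =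
      hahnSum n ((2 * a + b + c - 1 : ℕ) - n) (upCoord b r x) (a + c - 1 : ℕ) (r + a - 1 : ℕ) /
      (Real.sqrt (hahnNormSq (bPar b r) (aPar c r) (gammaPar a b c r) n) * n.factorial) := by
  have hγ : n ≤ gammaPar a b c r := by
    unfold gammaPar; split_ifs <;> omega
  have hD : 2 * gammaPar a b c r + bPar b r + aPar c r + 1 = 2 * a + b + c - 1 := by
    unfold gammaPar aPar bPar; split_ifs <;> omega
  rw [hahnPoly_eq_hahnSum _ _ hγ, hD]
  congr 1
  by_cases h : r ≤ b
  · have h2 : gammaPar a b c r + aPar c r = a + c - 1 := by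
      unfold gammaPar aPar; split_ifs; omega
    have h4 : gammaPar a b c r = r + a - 1 := by unfold gammaPar; split_ifs; omega
    rw [h2, h4, upCoord, if_pos h]
  -- After time `b` the Hahn coordinate is shifted by `r - b`; the transformation undoes exactly
  -- this shift. For `r ≤ c` the last two parameters must also be exchanged.
  · rw [hahnSum_transform n _ _ _ (a + b - 1 : ℕ) (r + a - 1 : ℕ) (a + b + c - 1 - r : ℕ)]
    · have hx : ((upCoord b r x : ℤ) : ℝ) + (a + b - 1 : ℕ) - (r + a - 1 : ℕ) = x := by
        have : upCoord b r x + (a + b - 1 : ℕ) - (r + a - 1 : ℕ) = x := by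
          rw [upCoord, if_neg h]; omega
        exact_mod_cast congrArg (Int.cast : ℤ → ℝ) this
      rw [hx]
      by_cases h' : r ≤ c
      · have h2 : gammaPar a b c r + aPar c r = a + b + c - 1 - r := by
          unfold gammaPar aPar; split_ifs; omega
        have h4 : gammaPar a b c r = a + b - 1 := by unfold gammaPar; split_ifs; omega
        rw [h2, h4, hahnSum_comm]
      · have h2 : gammaPar a b c r + aPar c r = a + b - 1 := by
          unfold gammaPar aPar; split_ifs; omega
        have h4 : gammaPar a b c r = a + b + c - 1 - r := by unfold gammaPar; split_ifs; omega
        rw [h2, h4]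
    · have : (a + c - 1) + (a + b - 1) + 1 = 2 * a + b + c - 1 := by omega
      rw [← this]; push_cast; ring
    · have : (r + a - 1) + (a + b + c - 1 - r) + 1 = 2 * a + b + c - 1 := by omega
      rw [← this]; push_cast; ring

/-- The inverse of the squared norm in the biorthogonality relations. -/
noncomputable def hahnCoeff (a b c n : ℕ) : ℝ :=
  (((2 * a + b + c - 1 : ℕ) : ℝ) - 2 * n) * (a + c - 1 - n).factorial * (a + b - 1 - n).factorial /
    ((2 * a + b + c - 1 - n).factorial * n.factorial)

theorem two_mul_lt_hahn_degree {n : ℕ} (hn : n < a) :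
    (0 : ℝ) < ((2 * a + b + c - 1 : ℕ) : ℝ) - 2 * n := by
  have : 2 * n < 2 * a + b + c - 1 := by omega
  have : ((2 * n : ℕ) : ℝ) < ((2 * a + b + c - 1 : ℕ) : ℝ) := Nat.cast_lt.2 this
  push_cast at this ⊢
  linarith

theorem hahnKernel_term (ha : 0 < a) (hbc : b ≤ c) {r s n : ℕ} (hr : r < b + c) (hs : s < b + c)
    (hn : n < a) (x y : ℤ) :
    Real.sqrt ((((a + s - 1 - n).factorial : ℝ) * ((a + b + c - r - 1 - n).factorial : ℝ)) /
        (((a + r - 1 - n).factorial : ℝ) * ((a + b + c - s - 1 - n).factorial : ℝ))) *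
      hahnPoly (bPar b r) (aPar c r) (gammaPar a b c r) n x *
      hahnPoly (bPar b s) (aPar c s) (gammaPar a b c s) n y *
      omegaPar a b c r x * omegaTildePar a b c s y =
    hahnCoeff a b c n *
      hahnFun n ((2 * a + b + c - 1 : ℕ) - n) (a + b - 1 : ℕ) (a + b + c - 1 - r)
        (upCoord b r x + (a + b - 1 : ℕ) - (r + a - 1 : ℕ)) *
      hahnFun n ((2 * a + b + c - 1 : ℕ) - n) (a + c - 1 : ℕ) (s + a - 1) (upCoord b s y) := by
  rw [hahnFun_eq_hahnSum _ _ (by omega), hahnFun_eq_hahnSum _ _ (by omega),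
    ← omegaTildePar_eq hs ha, ← omegaPar_eq hbc hr ha, hahnPoly_par hbc hr hn,
    hahnPoly_par hbc hs hn,
    hahnSum_transform n _ (upCoord b r x) _ (a + b - 1 : ℕ) (r + a - 1 : ℕ)
      (a + b + c - 1 - r : ℕ)]
  rotate_left
  · have : (a + c - 1) + (a + b - 1) + 1 = 2 * a + b + c - 1 := by omega
    rw [← this]; push_cast; ring
  · have : (r + a - 1) + (a + b + c - 1 - r) + 1 = 2 * a + b + c - 1 := by omega
    rw [← this]; push_cast; ring
  have hD := two_mul_lt_hahn_degree (b := b) (c := c) hn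
  set dr := hahnNormSq (bPar b r) (aPar c r) (gammaPar a b c r) n with hdr
  set ds := hahnNormSq (bPar b s) (aPar c s) (gammaPar a b c s) n with hds
  rw [hahnNormSq_par hbc hr hn] at hdr
  rw [hahnNormSq_par hbc hs hn] at hds
  have hpos : ∀ m : ℕ, (0 : ℝ) < m.factorial := fun m => Nat.cast_pos.2 m.factorial_pos
  have hdr0 : 0 < dr := by
    rw [hdr]
    have := hpos (2 * a + b + c - 1 - n)
    have := hpos n
    have := hpos (a + c - 1 - n)
    have := hpos (a + b - 1 - n)
    have := hpos (r + a - 1 - n)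
    have := hpos (a + b + c - 1 - r - n)
    positivity
  have hds0 : 0 < ds := by
    rw [hds]
    have := hpos (2 * a + b + c - 1 - n)
    have := hpos n
    have := hpos (a + c - 1 - n)
    have := hpos (a + b - 1 - n)
    have := hpos (s + a - 1 - n)
    have := hpos (a + b + c - 1 - s - n)
    positivity
  have hc0 : 0 < hahnCoeff a b c n := by
    unfold hahnCoeff
    have := hpos (2 * a + b + c - 1 - n)
    have := hpos n
    have := hpos (a + c - 1 - n)
    have := hpos (a + b - 1 - n)
    positivity
  -- The square root in the kernel equals the two normalizations `√dr`, `√ds` times the factorials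
  -- needed by the `hahnFun` form, as seen by comparing squares.
  have hsqrt : Real.sqrt ((((a + s - 1 - n).factorial : ℝ) *
      ((a + b + c - r - 1 - n).factorial : ℝ)) /
        (((a + r - 1 - n).factorial : ℝ) * ((a + b + c - s - 1 - n).factorial : ℝ))) =
      hahnCoeff a b c n * (n.factorial * n.factorial) * (a + b + c - 1 - r - n).factorial *
        (s + a - 1 - n).factorial * (Real.sqrt dr * Real.sqrt ds) := by
    rw [← Real.sqrt_mul hdr0.le]
    have hK : 0 ≤ hahnCoeff a b c n * (n.factorial * n.factorial) *
        (a + b + c - 1 - r - n).factorial * (s + a - 1 - n).factorial := by positivity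
    rw [← Real.sqrt_sq hK, ← Real.sqrt_mul (sq_nonneg _)]
    congr 1
    rw [hdr, hds, hahnCoeff, add_comm a s, add_comm a r, Nat.sub_right_comm _ r 1,
      Nat.sub_right_comm _ s 1]
    have := (hpos (2 * a + b + c - 1 - n)).ne'
    have := (hpos n).ne'
    have := (hpos (a + c - 1 - n)).ne'
    have := (hpos (a + b - 1 - n)).ne'
    have := (hpos (r + a - 1 - n)).ne'
    have := (hpos (a + b + c - 1 - r - n)).ne'
    have := (hpos (s + a - 1 - n)).ne'
    have := (hpos (a + b + c - 1 - s - n)).ne'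
    have := hD.ne'
    field_simp
  rw [hsqrt]
  have := (Real.sqrt_pos.2 hdr0).ne'
  have := (Real.sqrt_pos.2 hds0).ne'
  have := (hpos n).ne'
  push_cast
  field_simp

/-- The Hahn kernel in terms of the numbers of upward steps. -/
theorem hahnKernel_eq (ha : 0 < a) (hbc : b ≤ c) {r s : ℕ} (hr : r < b + c) (hs : s < b + c)
    (x y : ℤ) : hahnKernel a b c r x s y =
    -(if r < s then intChoose (s - r) (upCoord b s y - upCoord b r x) else 0) +
    ∑ n ∈ Finset.range a, hahnCoeff a b c n *
      hahnFun n ((2 * a + b + c - 1 : ℕ) - n) (a + b - 1 : ℕ) (a + b + c - 1 - r)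
        (upCoord b r x + (a + b - 1 : ℕ) - (r + a - 1 : ℕ)) *
      hahnFun n ((2 * a + b + c - 1 : ℕ) - n) (a + c - 1 : ℕ) (s + a - 1) (upCoord b s y) := by
  rw [hahnKernel, transition_eq]
  congr 1
  exact Finset.sum_congr rfl fun n hn => hahnKernel_term ha hbc hr hs (Finset.mem_range.1 hn) x y

end Kernel

/-! ### Transition weights on a finite window -/

/-- A finite window of the integers. -/
abbrev Window (M : ℕ) : Type := Finset.Icc (-(M : ℤ)) M

/-- The one step transition weights on a window. -/
def upMatrix (M : ℕ) : Matrix (Window M) (Window M) ℝ := Matrix.of fun x y => upStep x y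

theorem upStep_eq_intChoose (x y : ℤ) : upStep x y = intChoose 1 (y - x) := by
  unfold upStep
  split_ifs with h
  · rcases h with rfl | rfl <;> simp [intChoose]
  · rcases lt_or_ge y x with h' | h'
    · rw [intChoose_of_neg _ (by omega)]
    · rw [intChoose_of_lt _ (by omega)]

/-- Truncation to the window costs nothing: steps never go down, so every intermediate point lies
between the two end points. -/
theorem upMatrix_pow_apply (M s : ℕ) (x y : Window M) :
    (upMatrix M ^ s) x y = intChoose s (y - x) := by
  induction s generalizing y with
  | zero =>
    rw [pow_zero, Matrix.one_apply]
    split_ifs with h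
    · subst h; simp [intChoose]
    · have h : (x : ℤ) ≠ y := fun h' => h (Subtype.ext h')
      rcases lt_or_gt_of_ne h with h' | h'
      · rw [intChoose_of_lt _ (by omega)]
      · rw [intChoose_of_neg _ (by omega)]
  | succ s ih =>
    rw [pow_succ, Matrix.mul_apply]
    simp_rw [ih, upMatrix, Matrix.of_apply, upStep_eq_intChoose]
    rw [Finset.sum_coe_sort (Finset.Icc (-(M : ℤ)) M)
      (fun w => intChoose s (w - x) * intChoose 1 (y - w)), sum_intChoose_mul]
    intro i h1 _ h2
    have hx := Finset.mem_Icc.1 x.2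
    have hy := Finset.mem_Icc.1 y.2
    exact Finset.mem_Icc.2 ⟨by omega, by omega⟩

/-- The `a` consecutive points of a window which start at `d`. -/
noncomputable def blockEmb {M a d : ℕ} (h : a + d ≤ M) : Fin a ↪o Window M :=
  OrderEmbedding.ofStrictMono
    (fun j => ⟨d + j, Finset.mem_Icc.2 ⟨by omega, by omega⟩⟩)
    (fun i j hij => by
      have : (i : ℕ) < j := hij
      exact Subtype.mk_lt_mk.2 (by omega))

theorem blockEmb_coe {M a d : ℕ} (h : a + d ≤ M) (j : Fin a) :
    (blockEmb h j : ℤ) = d + j := rfl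

theorem sum_fin_eq_sum_Ico {β : Type*} [AddCommMonoid β] (a : ℕ) (f : ℤ → β) :
    ∑ k : Fin a, f k = ∑ i ∈ Finset.Ico (0 : ℤ) a, f i := by
  rw [Fin.sum_univ_eq_sum_range fun k : ℕ => f k]
  refine Finset.sum_nbij (fun k : ℕ => (k : ℤ)) ?_ ?_ ?_ fun _ _ => rfl
  · intro k hk
    have := Finset.mem_range.1 hk
    exact Finset.mem_Ico.2 ⟨by omega, by omega⟩
  · intro i _ j _ h; simpa using h
  · intro i hi
    have := Finset.mem_Ico.1 (Finset.mem_coe.1 hi)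
    refine ⟨i.toNat, ?_, ?_⟩
    · simp only [Finset.coe_range, Set.mem_Iio]; omega
    · simp only; omega

/-! ### Biorthogonality and the inverse of the end-to-end transition matrix. -/

section

variable {a b c : ℕ}

/-- The starting values of the biorthogonal functions. -/
noncomputable def hahnStart (a b c : ℕ) : Matrix (Fin a) (Fin a) ℝ :=
  Matrix.of fun n k =>
    hahnFun n ((2 * a + b + c - 1 : ℕ) - (n : ℕ)) (a + c - 1 : ℕ) (a - 1) (k : ℕ)

/-- The end values of the biorthogonal functions. -/
noncomputable def hahnEnd (a b c : ℕ) : Matrix (Fin a) (Fin a) ℝ :=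
  Matrix.of fun k n => hahnCoeff a b c n *
    hahnFun n ((2 * a + b + c - 1 : ℕ) - (n : ℕ)) (a + b - 1 : ℕ) (a - 1) (k : ℕ)

theorem sum_hahnStart_mul (n : Fin a) (s : ℕ) (i : ℤ) :
    ∑ k, hahnStart a b c n k * intChoose s (i - (k : ℕ)) =
      hahnFun n ((2 * a + b + c - 1 : ℕ) - (n : ℕ)) (a + c - 1 : ℕ) (s + a - 1) i := by
  have hn := n.2
  simp only [hahnStart, Matrix.of_apply]
  rw [sum_fin_eq_sum_Ico a fun k => hahnFun n ((2 * a + b + c - 1 : ℕ) - (n : ℕ))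
    (a + c - 1 : ℕ) (a - 1) k * intChoose s (i - k), hahnFun_evolve _ _ _ (by omega),
    show a - 1 + s = s + a - 1 by omega]
  intro k h1 h2 _
  exact Finset.mem_Ico.2 ⟨by omega, by omega⟩

/-- Reflecting the binomial turns backward evolution from the end points into forward evolution of a
`hahnFun`, with `b` in place of `c` and a shifted argument. -/
theorem sum_mul_hahnEnd (n : Fin a) {s : ℕ} (i : ℤ) :
    ∑ l : Fin a, intChoose s (c + (l : ℕ) - i) * hahnEnd a b c l n =
      hahnCoeff a b c n *
      hahnFun n ((2 * a + b + c - 1 : ℕ) - (n : ℕ)) (a + b - 1 : ℕ) (s + a - 1) (i + s - c) := by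
  have hn := n.2
  simp only [hahnEnd, Matrix.of_apply]
  have h : ∀ l : Fin a, intChoose s (c + (l : ℕ) - i) = intChoose s (i + s - c - (l : ℕ)) := by
    intro l
    rw [← intChoose_symm]
    congr 1
    ring
  simp_rw [h, mul_left_comm, ← Finset.mul_sum]
  congr 1
  simp_rw [mul_comm (intChoose s _)]
  rw [sum_fin_eq_sum_Ico a fun k => hahnFun n ((2 * a + b + c - 1 : ℕ) - (n : ℕ))
    (a + b - 1 : ℕ) (a - 1) k * intChoose s (i + s - c - k), hahnFun_evolve _ _ _ (by omega),
    show a - 1 + s = s + a - 1 by omega]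
  intro k h1 h2 _
  exact Finset.mem_Ico.2 ⟨by omega, by omega⟩

theorem upMatrix_pow_block {M : ℕ} (h0 : a + 0 ≤ M) (hc : a + c ≤ M) :
    (upMatrix M ^ (b + c)).submatrix (blockEmb h0) (blockEmb hc) =
      Matrix.of fun j l : Fin a => intChoose (b + c) (c + (l : ℕ) - (j : ℕ)) := by
  ext j l
  rw [Matrix.submatrix_apply, upMatrix_pow_apply, blockEmb_coe, blockEmb_coe]
  simp

/-- Carry the end functions back to time 0 and pair them there with the start functions; `hahnCoeff`
is the reciprocal of the diagonal pairing. -/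
theorem hahnStart_mul_hahnEnd {M : ℕ} (h0 : a + 0 ≤ M) (hc : a + c ≤ M) :
    hahnStart a b c *
      ((upMatrix M ^ (b + c)).submatrix (blockEmb h0) (blockEmb hc) * hahnEnd a b c) = 1 := by
  ext n m
  have hn := n.2
  have hm := m.2
  have h1 : ∀ k : Fin a, ((upMatrix M ^ (b + c)).submatrix (blockEmb h0) (blockEmb hc) *
      hahnEnd a b c) k m = hahnCoeff a b c m * hahnFun m ((2 * a + b + c - 1 : ℕ) - (m : ℕ))
        (a + b - 1 : ℕ) (b + c + a - 1) ((k : ℕ) + (a + b - 1 : ℕ) - (a - 1 : ℕ)) := by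
    intro k
    rw [upMatrix_pow_block, Matrix.mul_apply]
    simp only [Matrix.of_apply]
    rw [sum_mul_hahnEnd]
    congr 2
    omega
  rw [Matrix.mul_apply]
  simp_rw [h1, mul_left_comm _ (hahnCoeff a b c m), ← Finset.mul_sum, hahnStart, Matrix.of_apply]
  have hD : ∀ j : Fin a, ((2 * a + b + c - 1 : ℕ) : ℝ) - (j : ℕ) =
      ((a + c - 1 + (a + b - 1) : ℕ) : ℝ) + 1 - (j : ℕ) := by
    intro j
    rw [show 2 * a + b + c - 1 = a + c - 1 + (a + b - 1) + 1 by omega]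
    push_cast
    ring
  rw [hD, hD, sum_fin_eq_sum_Ico a fun k =>
    hahnFun n (((a + c - 1 + (a + b - 1) : ℕ) : ℝ) + 1 - (n : ℕ)) (a + c - 1 : ℕ) (a - 1) k *
      hahnFun m (((a + c - 1 + (a + b - 1) : ℕ) : ℝ) + 1 - (m : ℕ))
        (a + b - 1 : ℕ) (b + c + a - 1) (k + (a + b - 1 : ℕ) - (a - 1 : ℕ)),
    sum_hahnFun_mul_hahnFun (by omega) (by omega) (by omega) (by omega) (by omega)]
  · by_cases hnm : n = m
    · subst hnm
      rw [Matrix.one_apply_eq, hahnPairing_self _ _ (by omega), hahnCoeff,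
        show a + c - 1 + (a + b - 1) + 1 = 2 * a + b + c - 1 by omega]
      have h2 : ((a + c - 1 + (a + b - 1) : ℕ) : ℝ) + 1 = ((2 * a + b + c - 1 : ℕ) : ℝ) := by
        rw [show 2 * a + b + c - 1 = a + c - 1 + (a + b - 1) + 1 by omega, Nat.cast_succ]
      rw [h2]
      have := (two_mul_lt_hahn_degree (b := b) (c := c) hn).ne'
      have := factorial_cast_ne_zero n
      have := factorial_cast_ne_zero (a + c - 1 - n)
      have := factorial_cast_ne_zero (a + b - 1 - n)
      have := factorial_cast_ne_zero (2 * a + b + c - 1 - n)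
      field_simp
    · rw [Matrix.one_apply_ne hnm, hahnPairing_of_ne _ (by omega) (fun h => hnm (Fin.ext h)),
        zero_div, mul_zero]
  · intro k h3 h4 _
    exact Finset.mem_Ico.2 ⟨by omega, by omega⟩

theorem upMatrix_block_mul {M : ℕ} (h0 : a + 0 ≤ M) (hc : a + c ≤ M) :
    (upMatrix M ^ (b + c)).submatrix (blockEmb h0) (blockEmb hc) *
      (hahnEnd a b c * hahnStart a b c) = 1 := by
  rw [← Matrix.mul_assoc]
  exact mul_eq_one_comm.1 (hahnStart_mul_hahnEnd h0 hc)

theorem isUnit_det_upMatrix_block {M : ℕ} (h0 : a + 0 ≤ M) (hc : a + c ≤ M) :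
    IsUnit ((upMatrix M ^ (b + c)).submatrix (blockEmb h0) (blockEmb hc)).det :=
  (Matrix.isUnit_iff_isUnit_det _).1 (IsUnit.of_mul_eq_one _ (upMatrix_block_mul h0 hc))

theorem correlationMatrix_eq_hahnKernel {M k : ℕ} (ha : 0 < a) (hbc : b ≤ c) (h0 : a + 0 ≤ M)
    (hc : a + c ≤ M) (r : Fin k → Fin (b + c)) (x : Fin k → ℤ) (q : Fin k → Window M)
    (hq : ∀ i, (q i : ℤ) = upCoord b (r i) (x i)) :
    correlationMatrix (upMatrix M) (blockEmb h0) (blockEmb hc) r q =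
      Matrix.of fun i j => hahnKernel a b c (r i) (x i) (r j) (x j) := by
  rw [correlationMatrix, Matrix.inv_eq_right_inv (upMatrix_block_mul h0 hc)]
  ext i j
  have hi := (r i).2
  rw [Matrix.of_apply, hahnKernel_eq ha hbc (r i).2 (r j).2, Matrix.add_apply]
  congr 1
  · simp only [Matrix.neg_apply, interMatrix, Matrix.of_apply, upMatrix_pow_apply, hq, Fin.lt_def]
  · rw [← Matrix.mul_assoc, Matrix.mul_assoc, Matrix.mul_apply, Finset.sum_range]
    refine Finset.sum_congr rfl fun n _ => ?_
    congr 1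
    · rw [Matrix.mul_apply]
      simp only [endMatrix, Matrix.of_apply, upMatrix_pow_apply, blockEmb_coe, hq]
      rw [sum_mul_hahnEnd]
      have hn := n.2
      congr 2
      · omega
      · omega
    · rw [Matrix.mul_apply]
      simp only [startMatrix, Matrix.of_apply, upMatrix_pow_apply, blockEmb_coe, hq]
      simp only [Nat.cast_zero, zero_add]
      rw [sum_hahnStart_mul]

end

/-! ### Non-intersecting configurations -/

section Configurations

variable {a b c : ℕ}

theorem position_zero (z : Config a b c) (j : Fin a) : position z 0 j = 2 * (j : ℤ) := by
  simp [position]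

theorem position_of_lt (z : Config a b c) (r : InnerTime b c) (j : Fin a) :
    position z r j = z r j := by
  rw [position, dif_pos r.2]

theorem position_last (hb : 0 < b) (z : Config a b c) (j : Fin a) :
    position z (b + c) j = (c : ℤ) - b + 2 * (j : ℤ) := by
  rw [position, dif_neg (by simp), if_neg (by omega)]

theorem strictMono_position {z : Config a b c} (hz : ∀ r, StrictMono (z r)) (t : ℕ) :
    StrictMono (position z t) := by
  intro i j hij
  have h : (i : ℤ) < j := by exact_mod_cast hij
  unfold position
  split_ifs with h1 h2
  · exact hz _ hij
  · omega
  · omega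

/-- The parity conditions allow halving `x + t` and `y + t + 1`, which turns steps `±1` into steps 0
or 1 as `det_upStep` requires. -/
theorem det_stepKernel {x y : Fin a → ℤ} (hx : StrictMono x) (hy : StrictMono y) (t : ℤ)
    (hx2 : ∀ j, 2 ∣ x j + t) (hy2 : ∀ j, 2 ∣ y j + t + 1) :
    (Matrix.of fun j k => stepKernel (x j) (y k)).det =
      if ∀ j, y j = x j + 1 ∨ y j = x j - 1 then 1 else 0 := by
  choose u hu using hx2
  choose v hv using hy2
  have hum : StrictMono u := fun i j hij => by
    have := hx hij
    have := hu i
    have := hu j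
    omega
  have hvm : StrictMono v := fun i j hij => by
    have := hy hij
    have := hv i
    have := hv j
    omega
  have h : ∀ j k, stepKernel (x j) (y k) = upStep (u j) (v k) := by
    intro j k
    have := hu j
    have := hv k
    unfold stepKernel upStep
    by_cases h1 : v k = u j
    · rw [if_pos (by omega), if_neg (by omega), if_pos (by omega), add_zero]
    · by_cases h2 : v k = u j + 1
      · rw [if_neg (by omega), if_pos (by omega), if_pos (by omega), zero_add]
      · rw [if_neg (by omega), if_neg (by omega), if_neg (by omega), zero_add]
  simp_rw [h]
  rw [det_upStep hum hvm]
  refine if_congr (forall_congr' fun j => ?_) rfl rfl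
  have := hu j
  have := hv j
  omega

/-- Some permutation term is nonzero, so each `y j` is a neighbour of some `x (σ j)`. This
propagates parity in time before any path structure is known. -/
theorem parity_of_det_ne_zero {x y : Fin a → ℤ} {t : ℤ} (hx2 : ∀ j, 2 ∣ x j + t)
    (h : (Matrix.of fun j k => stepKernel (x j) (y k)).det ≠ 0) (j : Fin a) :
    2 ∣ y j + t + 1 := by
  rw [Matrix.det_apply'] at h
  obtain ⟨σ, -, hσ⟩ := Finset.exists_ne_zero_of_sum_ne_zero h
  have h1 := Finset.prod_ne_zero_iff.1 (right_ne_zero_of_mul hσ) j (Finset.mem_univ j)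
  have h2 := hx2 (σ j)
  rw [Matrix.of_apply, stepKernel] at h1
  by_contra h3
  apply h1
  rw [if_neg (by omega), if_neg (by omega), add_zero]

open Classical in
theorem prod_det_stepKernel {z : Config a b c} (hz : ∀ r, StrictMono (z r)) :
    ∏ t ∈ Finset.range (b + c),
      (Matrix.of fun j k : Fin a => stepKernel (position z t j) (position z (t + 1) k)).det =
      if z ∈ nonintersectingConfigs a b c then 1 else 0 := by
  have hm := strictMono_position hz
  split_ifs with h
  · have hpar : ∀ t ≤ b + c, ∀ j, (2 : ℤ) ∣ position z t j + t := by
      intro t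
      induction t with
      | zero => intro _ j; rw [position_zero]; simp
      | succ t ih =>
        intro ht j
        have h1 := ih (by omega) j
        have h2 := h.2 t (by omega) j
        push_cast
        omega
    refine Finset.prod_eq_one fun t ht => ?_
    have ht := Finset.mem_range.1 ht
    rw [det_stepKernel (hm t) (hm (t + 1)) t (hpar t ht.le), if_pos (h.2 t ht)]
    intro j
    have := hpar (t + 1) ht j
    push_cast at this
    rwa [← add_assoc] at this
  · by_contra hne
    have hdet := Finset.prod_ne_zero_iff.1 hne
    have hpar : ∀ t ≤ b + c, ∀ j, (2 : ℤ) ∣ position z t j + t := by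
      intro t
      induction t with
      | zero => intro _ j; rw [position_zero]; simp
      | succ t ih =>
        intro ht j
        have := parity_of_det_ne_zero (ih (by omega)) (hdet t (Finset.mem_range.2 (by omega))) j
        push_cast
        rwa [← add_assoc]
    refine h ⟨hz, fun t ht => ?_⟩
    have h1 := hdet t (Finset.mem_range.2 ht)
    rw [det_stepKernel (hm t) (hm (t + 1)) t (hpar t ht.le)] at h1
    · by_contra h2
      exact h1 (if_neg h2)
    · intro j
      have := hpar (t + 1) ht j
      push_cast at this
      rwa [← add_assoc] at this

open Classical in
theorem configWeight_eq (z : Config a b c) :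
    configWeight a b c z =
      if z ∈ nonintersectingConfigs a b c then 1 / (partitionFunction a b c : ℝ) else 0 := by
  unfold configWeight
  split_ifs with h1 h2 h2
  · rw [prod_det_stepKernel h1, if_pos h2, mul_one]
  · rw [prod_det_stepKernel h1, if_neg h2, mul_zero]
  · exact absurd h2.1 h1
  · rfl

theorem exists_up_steps {z : Config a b c} (hz : z ∈ nonintersectingConfigs a b c) {t : ℕ}
    (ht : t ≤ b + c) (j : Fin a) :
    ∃ m : ℕ, m ≤ t ∧ position z t j = 2 * (j : ℤ) - t + 2 * m := by
  induction t with
  | zero => exact ⟨0, le_rfl, by rw [position_zero]; simp⟩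
  | succ t ih =>
    obtain ⟨m, hm, h⟩ := ih (by omega)
    rcases hz.2 t (by omega) j with h1 | h1
    · exact ⟨m + 1, by omega, by rw [h1, h]; push_cast; ring⟩
    · exact ⟨m, by omega, by rw [h1, h]; push_cast; ring⟩

/-! ### Encoding by upward steps -/

/-- The families of paths in a window whose steps stay or go up by one. -/
def upPaths (b c : ℕ) {M : ℕ} (x y : Fin a ↪o Window M) :
    Set (Fin (b + c + 1) → Fin a ↪o Window M) :=
  {p | (p 0 = x ∧ p (Fin.last _) = y) ∧ ∀ (t : Fin (b + c)) j,
    (p t.succ j : ℤ) = p t.castSucc j ∨ (p t.succ j : ℤ) = p t.castSucc j + 1}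

/-- The configuration given by a family of paths which count upward steps. -/
def configOfUpPath {M : ℕ} (p : Fin (b + c + 1) → Fin a ↪o Window M) : Config a b c :=
  fun r j => 2 * (p ⟨r, r.2.2.trans (Nat.lt_succ_self _)⟩ j : ℤ) - (r : ℕ)

theorem position_configOfUpPath {M : ℕ} (hb : 0 < b) (h0 : a + 0 ≤ M) (hc : a + c ≤ M)
    {p : Fin (b + c + 1) → Fin a ↪o Window M}
    (hp : p 0 = blockEmb h0 ∧ p (Fin.last _) = blockEmb hc) (t : Fin (b + c + 1)) (j : Fin a) :
    position (configOfUpPath p) t j = 2 * (p t j : ℤ) - (t : ℕ) := by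
  rcases Nat.eq_zero_or_pos (t : ℕ) with h | h
  · have : t = 0 := Fin.ext h
    rw [this, hp.1, blockEmb_coe]
    simp [position_zero]
  · rcases Nat.lt_or_ge (t : ℕ) (b + c) with h' | h'
    · exact position_of_lt (configOfUpPath p) ⟨t, h, h'⟩ j
    · have : t = Fin.last _ := Fin.ext (le_antisymm (Nat.lt_succ_iff.1 t.2) h')
      rw [this, hp.2, blockEmb_coe, Fin.val_last, position_last hb]
      push_cast
      ring

theorem bijOn_configOfUpPath {M : ℕ} (hb : 0 < b) (h0 : a + 0 ≤ M) (hc : a + c ≤ M)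
    (hM : a + b + c ≤ M) :
    Set.BijOn configOfUpPath (upPaths b c (blockEmb h0) (blockEmb hc))
      (nonintersectingConfigs a b c) := by
  refine ⟨fun p hp => ⟨fun r i j hij => ?_, fun t ht j => ?_⟩, fun p hp p' hp' h => ?_,
    fun z hz => ?_⟩
  · have : (p ⟨r, r.2.2.trans (Nat.lt_succ_self _)⟩ i : ℤ) <
      p ⟨r, r.2.2.trans (Nat.lt_succ_self _)⟩ j :=
      (p ⟨r, r.2.2.trans (Nat.lt_succ_self _)⟩).strictMono hij
    unfold configOfUpPath
    omega
  · have h1 := position_configOfUpPath hb h0 hc hp.1 (Fin.succ ⟨t, ht⟩) j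
    have h2 := position_configOfUpPath hb h0 hc hp.1 (Fin.castSucc ⟨t, ht⟩) j
    have h3 := hp.2 ⟨t, ht⟩ j
    simp only [Fin.val_succ, Fin.val_castSucc] at h1 h2
    push_cast at h1
    omega
  · funext t
    refine DFunLike.ext _ _ fun j => Subtype.ext ?_
    have h1 := position_configOfUpPath hb h0 hc hp.1 t j
    have h2 := position_configOfUpPath hb h0 hc hp'.1 t j
    rw [h] at h1
    omega
  · have hex : ∀ (t : Fin (b + c + 1)) (j : Fin a), ∃ m : ℕ, m ≤ (t : ℕ) ∧
        position z t j = 2 * (j : ℤ) - (t : ℕ) + 2 * m := fun t j =>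
      exists_up_steps hz (Nat.lt_succ_iff.1 t.2) j
    choose m hm hpos using hex
    -- At most `b + c` upward steps are added to `j < a`, and `M` was taken large enough for this.
    have hmem : ∀ t (j : Fin a), ((j : ℕ) : ℤ) + m t j ∈ Finset.Icc (-(M : ℤ)) M := fun t j => by
      have := hm t j
      have := t.2
      have := j.2
      exact Finset.mem_Icc.2 ⟨by omega, by omega⟩
    have hmono : ∀ t, StrictMono fun j => (⟨_, hmem t j⟩ : Window M) := fun t i j hij => by
      have h1 := strictMono_position hz.1 t hij
      rw [hpos, hpos] at h1
      exact Subtype.mk_lt_mk.2 (by omega)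
    refine ⟨fun t => OrderEmbedding.ofStrictMono _ (hmono t), ⟨⟨?_, ?_⟩, fun t j => ?_⟩, ?_⟩
    · refine DFunLike.ext _ _ fun j => Subtype.ext ?_
      have := hm 0 j
      rw [blockEmb_coe]
      simp only [OrderEmbedding.coe_ofStrictMono, Fin.val_zero] at this ⊢
      push_cast
      omega
    · refine DFunLike.ext _ _ fun j => Subtype.ext ?_
      have := hpos (Fin.last _) j
      rw [Fin.val_last, position_last hb] at this
      rw [blockEmb_coe]
      simp only [OrderEmbedding.coe_ofStrictMono]
      push_cast at this
      omega
    · have h1 := hpos t.succ j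
      have h2 := hpos t.castSucc j
      have h3 := hz.2 t t.2 j
      simp only [Fin.val_succ, Fin.val_castSucc] at h1 h2
      simp only [OrderEmbedding.coe_ofStrictMono]
      push_cast at h1
      omega
    · funext r j
      have h1 := hpos ⟨r, r.2.2.trans (Nat.lt_succ_self _)⟩ j
      simp only [position_of_lt] at h1
      simp only [configOfUpPath, OrderEmbedding.coe_ofStrictMono]
      omega

theorem finite_nonintersectingConfigs (hb : 0 < b) : (nonintersectingConfigs a b c).Finite := by
  have h0 : a + 0 ≤ a + b + c := by omega
  have hc : a + c ≤ a + b + c := by omega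
  rw [← (bijOn_configOfUpPath hb h0 hc le_rfl).image_eq]
  exact (Set.toFinite _).image _

theorem prod_minorMatrix_upMatrix {M T : ℕ} (p : Fin (T + 1) → Fin a ↪o Window M)
    [Decidable (∀ (t : Fin T) j,
      (p t.succ j : ℤ) = p t.castSucc j ∨ (p t.succ j : ℤ) = p t.castSucc j + 1)] :
    ∏ t : Fin T, minorMatrix a (upMatrix M) (p t.castSucc) (p t.succ) =
      if ∀ (t : Fin T) j,
        (p t.succ j : ℤ) = p t.castSucc j ∨ (p t.succ j : ℤ) = p t.castSucc j + 1
      then 1 else 0 := by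
  have h : ∀ t : Fin T, minorMatrix a (upMatrix M) (p t.castSucc) (p t.succ) =
      if ∀ j, (p t.succ j : ℤ) = p t.castSucc j ∨ (p t.succ j : ℤ) = p t.castSucc j + 1
      then 1 else 0 := by
    intro t
    have h1 : ∀ s, StrictMono fun j => (p s j : ℤ) := fun s i j hij => (p s).strictMono hij
    rw [← det_upStep (h1 _) (h1 _)]
    rfl
  simp_rw [h]
  rw [Finset.prod_ite_zero]
  simp

/-- The number of families of paths through given points is a determinant. -/
theorem ncard_upPaths_through {M k : ℕ} (h0 : a + 0 ≤ M) (hc : a + c ≤ M) {r : Fin k → Fin (b + c)}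
    {q : Fin k → Window M} (hinj : Function.Injective fun i => (r i, q i)) :
    (({p ∈ upPaths b c (blockEmb h0 : Fin a ↪o Window M) (blockEmb hc) |
      ∀ i, ∃ j, p (r i).castSucc j = q i}.ncard : ℕ) : ℝ) =
      ((upMatrix M ^ (b + c)).submatrix (blockEmb h0) (blockEmb hc)).det *
        (correlationMatrix (upMatrix M) (blockEmb h0 : Fin a ↪o Window M) (blockEmb hc) r q).det := by
  classical
  refine Eq.trans ?_ (sum_minor_paths_through (upMatrix M) (blockEmb h0) (blockEmb hc) hinj
    (isUnit_det_upMatrix_block h0 hc))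
  rw [Set.ncard_eq_toFinset_card', Finset.card_eq_sum_ones,
    Nat.cast_sum, Set.toFinset_ofPred, Finset.sum_filter]
  refine Finset.sum_congr rfl fun p _ => ?_
  rw [prod_minorMatrix_upMatrix, Finset.prod_ite_zero, Finset.prod_const_one]
  rw [ite_zero_mul_ite_zero, one_mul, ← ite_and, Nat.cast_one]
  have h : (p ∈ upPaths b c (blockEmb h0 : Fin a ↪o Window M) (blockEmb hc) ∧
      ∀ i, ∃ j, p (r i).castSucc j = q i) ↔
      (p 0 = blockEmb h0 ∧ p (Fin.last _) = blockEmb hc) ∧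
        (∀ i ∈ Finset.univ, ∃ j, p (r i).castSucc j = q i) ∧ ∀ (t : Fin (b + c)) j,
          (p t.succ j : ℤ) = p t.castSucc j ∨ (p t.succ j : ℤ) = p t.castSucc j + 1 := by
    simp only [upPaths, Set.mem_ofPred_eq, Finset.mem_univ, true_implies]
    tauto
  by_cases hp : p ∈ upPaths b c (blockEmb h0 : Fin a ↪o Window M) (blockEmb hc) ∧
      ∀ i, ∃ j, p (r i).castSucc j = q i
  · rw [if_pos hp, if_pos (h.1 hp)]
  · rw [if_neg hp, if_neg fun h' => hp (h.2 h')]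

end Configurations

/-! ### The uniform measure on configurations -/

section Measures

variable {a b c : ℕ}

theorem nonempty_nonintersectingConfigs (hb : 0 < b) : (nonintersectingConfigs a b c).Nonempty := by
  -- The witness lets every walker go up `c` times and then down `b` times; the truncated
  -- subtraction `t - c` counts the downward steps.
  have hpos : ∀ t ≤ b + c, ∀ j : Fin a,
      position (fun (r : InnerTime b c) (j : Fin a) =>
        2 * (j : ℤ) + (r : ℕ) - 2 * ((r : ℕ) - c : ℕ)) t j = 2 * (j : ℤ) + t - 2 * (t - c : ℕ) := by
    intro t ht j
    unfold position
    split_ifs with h1 h2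
    · rfl
    · subst h2; simp
    · have : t = b + c := by
        by_contra hne
        exact h1 ⟨by omega, by omega⟩
      omega
  refine ⟨fun (r : InnerTime b c) (j : Fin a) => 2 * (j : ℤ) + (r : ℕ) - 2 * ((r : ℕ) - c : ℕ),
    fun r i j hij => ?_, fun t ht j => ?_⟩
  rotate_left
  · rw [hpos _ ht.le, hpos _ ht]
    omega
  · have h : (i : ℕ) < j := hij
    simp only
    omega

theorem measurableSet_config (s : Set (Config a b c)) : MeasurableSet s :=
  s.to_countable.measurableSet

theorem partitionFunction_eq : partitionFunction a b c = (nonintersectingConfigs a b c).ncard :=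
  rfl

theorem count_nonintersectingConfigs (hb : 0 < b) :
    Measure.count (nonintersectingConfigs a b c) = (partitionFunction a b c : ENNReal) := by
  rw [Measure.count_apply (measurableSet_config _), partitionFunction_eq,
    ← (finite_nonintersectingConfigs hb).cast_ncard_eq]
  simp

theorem partitionFunction_pos (hb : 0 < b) : 0 < partitionFunction a b c :=
  (Set.ncard_pos (finite_nonintersectingConfigs hb)).2 (nonempty_nonintersectingConfigs hb)

theorem configMeasure_eq_uniformOn (hb : 0 < b) :
    configMeasure a b c = uniformOn (nonintersectingConfigs a b c) := by
  classical
  have h : (fun z : Config a b c => ENNReal.ofReal (configWeight a b c z)) =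
      (nonintersectingConfigs a b c).indicator
        fun _ => (partitionFunction a b c : ENNReal)⁻¹ := by
    funext z
    rw [configWeight_eq, Set.indicator_apply]
    split_ifs
    · rw [one_div, ENNReal.ofReal_inv_of_pos (Nat.cast_pos.2 (partitionFunction_pos hb)),
        ENNReal.ofReal_natCast]
    · exact ENNReal.ofReal_zero
  rw [configMeasure, h, withDensity_indicator (measurableSet_config _), withDensity_const,
    uniformOn, ProbabilityTheory.cond, count_nonintersectingConfigs hb]

theorem uniformOn_real_nonintersectingConfigs (hb : 0 < b) (s : Set (Config a b c)) :
    (uniformOn (nonintersectingConfigs a b c)).real s =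
      ((nonintersectingConfigs a b c ∩ s).ncard : ℝ) / (partitionFunction a b c : ℝ) := by
  have hf : (nonintersectingConfigs a b c ∩ s).Finite :=
    (finite_nonintersectingConfigs hb).subset Set.inter_subset_left
  rw [Measure.real, uniformOn, cond_apply (measurableSet_config _),
    count_nonintersectingConfigs hb, Measure.count_apply (measurableSet_config _),
    ← hf.cast_ncard_eq]
  simp [div_eq_inv_mul]

/-! ### The conditioned random walks -/

section Walks

variable {Ω : Type*} [MeasurableSpace Ω] {P : Measure Ω} {ξ : Fin a → ℕ → Ω → ℤ}

omit [MeasurableSpace Ω] in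
theorem walk_succ (j : Fin a) (t : ℕ) (ω : Ω) : walk ξ j (t + 1) ω = walk ξ j t ω + ξ j t ω := by
  rw [walk, walk, Finset.sum_range_succ, add_assoc]

theorem IsFairSteps.measurable_walk (hξ : IsFairSteps P ξ) (j : Fin a) (t : ℕ) :
    Measurable (walk ξ j t) :=
  measurable_const.add (Finset.measurable_fun_sum _ fun i _ => hξ.measurable j i)

theorem IsFairSteps.measurable_config (hξ : IsFairSteps P ξ) :
    Measurable fun ω (r : InnerTime b c) j => walk ξ j r ω :=
  measurable_pi_lambda _ fun r => measurable_pi_lambda _ fun j => hξ.measurable_walk j r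

theorem IsFairSteps.ae_step [IsProbabilityMeasure P] (hξ : IsFairSteps P ξ) :
    ∀ᵐ ω ∂P, ∀ j t, ξ j t ω = 1 ∨ ξ j t ω = -1 := by
  rw [ae_all_iff]
  intro j
  rw [ae_all_iff]
  intro t
  have hm : ∀ k : ℤ, MeasurableSet {ω | ξ j t ω = k} := fun k =>
    hξ.measurable j t (MeasurableSet.singleton k)
  have hu : P ({ω | ξ j t ω = 1} ∪ {ω | ξ j t ω = -1}) = 1 := by
    rw [measure_union _ (hm _), hξ.prob_up, hξ.prob_down, ENNReal.add_halves]
    rw [Set.disjoint_left]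
    intro ω h1 h2
    have h1 : ξ j t ω = 1 := h1
    have h2 : ξ j t ω = -1 := h2
    omega
  exact (prob_compl_eq_zero_iff ((hm _).union (hm _))).2 hu

omit [MeasurableSpace Ω] in
theorem walk_eq_position {ω : Ω} (hω : ω ∈ nonintersectionEvent b c ξ) {t : ℕ}
    (ht : t ≤ b + c) (j : Fin a) :
    position (fun (r : InnerTime b c) j => walk ξ j r ω) t j = walk ξ j t ω := by
  unfold position
  split_ifs with h1 h2
  · rfl
  · subst h2; simp [walk]
  · have : t = b + c := by
      by_contra hne
      exact h1 ⟨by omega, by omega⟩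
    rw [this, hω.1]

omit [MeasurableSpace Ω] in
-- All walks share the parity of the time, so ordered walkers are at least 2 apart and cannot
-- exchange order in one step without meeting.
theorem walk_mem_nonintersectingConfigs {ω : Ω}
    (hω : ω ∈ nonintersectionEvent b c ξ) (hstep : ∀ j t, ξ j t ω = 1 ∨ ξ j t ω = -1) :
    (fun (r : InnerTime b c) j => walk ξ j r ω) ∈ nonintersectingConfigs a b c := by
  have h : ∀ t ≤ b + c, (∀ j, (2 : ℤ) ∣ walk ξ j t ω + t) ∧
      StrictMono fun j => walk ξ j t ω := by
    intro t
    induction t with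
    | zero =>
      intro _
      refine ⟨fun j => by simp [walk], fun i j hij => ?_⟩
      have h : (i : ℤ) < j := by exact_mod_cast hij
      simpa [walk] using h
    | succ t ih =>
      intro ht
      obtain ⟨h1, h2⟩ := ih (by omega)
      refine ⟨fun j => ?_, fun i j hij => ?_⟩
      · have := h1 j
        rw [walk_succ]
        push_cast
        rcases hstep j t with h | h <;> omega
      · have h3 := h1 i
        have h4 := h1 j
        have h5 := h2 hij
        have h6 := hω.2 (t + 1) ht i j hij.ne
        simp only [walk_succ] at h5 h6 ⊢
        rcases hstep i t with h | h <;> rcases hstep j t with h' | h' <;> omega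
  refine ⟨fun r => (h r r.2.2.le).2, fun t ht j => ?_⟩
  rw [walk_eq_position hω ht, walk_eq_position hω ht.le, walk_succ]
  rcases hstep j t with h | h <;> omega

omit [MeasurableSpace Ω] in
theorem nonintersectionEvent_inter_preimage (hb : 0 < b) {z : Config a b c}
    (hz : z ∈ nonintersectingConfigs a b c) :
    nonintersectionEvent b c ξ ∩ (fun ω (r : InnerTime b c) j => walk ξ j r ω) ⁻¹' {z} =
      ⋂ i ∈ (Finset.univ ×ˢ Finset.range (b + c) : Finset (Fin a × ℕ)),
        (fun ω => ξ i.1 i.2 ω) ⁻¹' {position z (i.2 + 1) i.1 - position z i.2 i.1} := by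
  ext ω
  simp only [Set.mem_inter_iff, Set.mem_preimage, Set.mem_singleton_iff, Set.mem_iInter,
    Finset.mem_product, Finset.mem_univ, true_and, Finset.mem_range, Prod.forall]
  constructor
  · rintro ⟨hω, rfl⟩ j t ht
    rw [walk_eq_position hω ht, walk_eq_position hω ht.le, walk_succ]
    ring
  · intro h
    have hw : ∀ t ≤ b + c, ∀ j, walk ξ j t ω = position z t j := by
      intro t
      induction t with
      | zero => intro _ j; rw [position_zero]; simp [walk]
      | succ t ih =>
        intro ht j
        rw [walk_succ, ih (by omega), h j t (by omega)]
        ring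
    refine ⟨⟨fun j => ?_, fun t ht i j hij => ?_⟩, ?_⟩
    · rw [hw _ le_rfl, position_last hb]
    · rw [hw t ht, hw t ht]
      exact (strictMono_position hz.1 t).injective.ne hij
    · funext r j
      rw [hw r r.2.2.le, position_of_lt]

/-- Inside the event, a non-intersecting configuration amounts to prescribing `a (b + c)`
independent fair steps, so all have the same mass. Any other configuration would need a step outside
`±1`, which has probability zero. -/
theorem IsFairSteps.map_restrict [IsProbabilityMeasure P] (hb : 0 < b) (hξ : IsFairSteps P ξ) :
    Measure.map (fun ω (r : InnerTime b c) j => walk ξ j r ω)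
      (P.restrict (nonintersectionEvent b c ξ)) =
      ((1 / 2 : ENNReal) ^ (a * (b + c))) •
        Measure.count.restrict (nonintersectingConfigs a b c) := by
  refine Measure.ext_of_singleton fun z => ?_
  rw [Measure.map_apply hξ.measurable_config (MeasurableSet.singleton z),
    Measure.restrict_apply (hξ.measurable_config (MeasurableSet.singleton z)), Set.inter_comm,
    Measure.smul_apply, Measure.restrict_apply (MeasurableSet.singleton z)]
  by_cases hz : z ∈ nonintersectingConfigs a b c
  · rw [nonintersectionEvent_inter_preimage hb hz,
      hξ.indep.measure_inter_preimage_eq_mul _ fun i _ => MeasurableSet.singleton _,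
      Set.inter_eq_left.2 (Set.singleton_subset_iff.2 hz), Measure.count_singleton, smul_eq_mul,
      mul_one]
    have h : ∀ i ∈ (Finset.univ ×ˢ Finset.range (b + c) : Finset (Fin a × ℕ)),
        P ((fun ω => ξ i.1 i.2 ω) ⁻¹' {position z (i.2 + 1) i.1 - position z i.2 i.1}) =
          1 / 2 := by
      intro i hi
      have hi : i.2 < b + c := by simpa using hi
      rcases hz.2 i.2 hi i.1 with h | h
      · rw [h, add_sub_cancel_left]
        exact hξ.prob_up i.1 i.2
      · rw [h, sub_sub_cancel_left]
        exact hξ.prob_down i.1 i.2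
    rw [Finset.prod_congr rfl h, Finset.prod_const, Finset.card_product, Finset.card_univ,
      Fintype.card_fin, Finset.card_range]
  · rw [Set.singleton_inter_eq_empty.2 hz, measure_empty, smul_zero]
    refine measure_mono_null (fun ω hω => ?_) (ae_iff.1 hξ.ae_step)
    intro hstep
    apply hz
    rw [← show (fun (r : InnerTime b c) j => walk ξ j r ω) = z from hω.2]
    exact walk_mem_nonintersectingConfigs hω.1 hstep

theorem IsFairSteps.measure_nonintersectionEvent [IsProbabilityMeasure P] (hb : 0 < b)
    (hξ : IsFairSteps P ξ) : P (nonintersectionEvent b c ξ) =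
      (1 / 2 : ENNReal) ^ (a * (b + c)) * partitionFunction a b c := by
  have h := congrArg (fun μ => μ Set.univ) (hξ.map_restrict (c := c) hb)
  simpa [Measure.map_apply hξ.measurable_config MeasurableSet.univ,
    count_nonintersectingConfigs hb] using h

theorem IsFairSteps.map_cond [IsProbabilityMeasure P] (hb : 0 < b) (hξ : IsFairSteps P ξ) :
    P (nonintersectionEvent b c ξ) ≠ 0 ∧
    Measure.map (fun ω (r : InnerTime b c) j => walk ξ j r ω)
      (ProbabilityTheory.cond P (nonintersectionEvent b c ξ)) = configMeasure a b c := by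
  have hZ : (partitionFunction a b c : ENNReal) ≠ 0 :=
    Nat.cast_ne_zero.2 (partitionFunction_pos hb).ne'
  have hh0 : ((1 / 2 : ENNReal) ^ (a * (b + c))) ≠ 0 := pow_ne_zero _ (by simp)
  have hht : ((1 / 2 : ENNReal) ^ (a * (b + c))) ≠ ⊤ := ENNReal.pow_ne_top (by simp)
  rw [hξ.measure_nonintersectionEvent hb]
  refine ⟨mul_ne_zero hh0 hZ, ?_⟩
  rw [configMeasure_eq_uniformOn hb, ProbabilityTheory.cond, Measure.map_smul,
    hξ.map_restrict hb, uniformOn, ProbabilityTheory.cond, hξ.measure_nonintersectionEvent hb,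
    count_nonintersectingConfigs hb, smul_smul]
  congr 1
  rw [ENNReal.mul_inv (Or.inl hh0) (Or.inl hht), mul_right_comm, ENNReal.inv_mul_cancel hh0 hht,
    one_mul]

end Walks

/-! ### The determinantal structure -/

theorem ae_mem_lattice (hb : 0 < b) : ∀ᵐ z ∂configMeasure a b c,
    ∀ (r : InnerTime b c) j, ∃ x : ℤ, z r j = alphaPar b r + 2 * x := by
  rw [configMeasure_eq_uniformOn hb]
  refine ae_cond_of_forall_mem (measurableSet_config _) fun z hz r j => ?_
  obtain ⟨m, -, h⟩ := exists_up_steps hz r.2.2.le j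
  rw [position_of_lt] at h
  rw [h, alphaPar]
  split_ifs
  · exact ⟨j + m, by ring⟩
  · exact ⟨j + m - r + b, by ring⟩

theorem mem_particles_configOfUpPath {M : ℕ} (p : Fin (b + c + 1) → Fin a ↪o Window M)
    (r : InnerTime b c) (x : ℤ) (q : Window M) (hq : (q : ℤ) = upCoord b r x) :
    (r, x) ∈ particles (configOfUpPath p) ↔ ∃ j, p (Fin.castSucc ⟨r, r.2.2⟩) j = q := by
  refine exists_congr fun j => ?_
  rw [alphaPar_add, ← hq, Subtype.ext_iff]
  change 2 * (p (Fin.castSucc ⟨r, r.2.2⟩) j : ℤ) - (r : ℕ) =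
    -((r : ℕ) : ℤ) + 2 * (q : ℤ) ↔ _
  omega

theorem isDeterminantal_configMeasure (ha : 0 < a) (hb : 0 < b) (hbc : b ≤ c) :
    IsDeterminantal (configMeasure a b c) particles
      (fun p q => hahnKernel a b c p.1 p.2 q.1 q.2) := by
  intro k p hp
  -- The window must contain all path families and also the prescribed points, which may be
  -- unreachable.
  obtain ⟨M, hM, hMp⟩ : ∃ M : ℕ, a + b + c ≤ M ∧ ∀ i, (upCoord b (p i).1 (p i).2).natAbs ≤ M := by
    refine ⟨a + b + c + ∑ i, (upCoord b (p i).1 (p i).2).natAbs, by omega, fun i => ?_⟩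
    exact (Finset.single_le_sum (f := fun i => (upCoord b (p i).1 (p i).2).natAbs)
      (fun _ _ => Nat.zero_le _) (Finset.mem_univ i)).trans (by omega)
  have h0 : a + 0 ≤ M := by omega
  have hc : a + c ≤ M := by omega
  let r : Fin k → Fin (b + c) := fun i => ⟨(p i).1, (p i).1.2.2⟩
  let q : Fin k → Window M := fun i => ⟨upCoord b (p i).1 (p i).2, Finset.mem_Icc.2
    (by have := hMp i; omega)⟩
  have hinj : Function.Injective fun i => (r i, q i) := by
    intro i j hij
    have h1 : ((p i).1 : ℕ) = (p j).1 := congrArg (fun u => ((u.1 : Fin (b + c)) : ℕ)) hij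
    have h2 : upCoord b (p i).1 (p i).2 = upCoord b (p j).1 (p j).2 :=
      congrArg (fun u => ((u.2 : Window M) : ℤ)) hij
    rw [h1] at h2
    exact hp (Prod.ext (Subtype.ext h1) (upCoord_injective b _ h2))
  have hbij := bijOn_configOfUpPath hb h0 hc hM
  -- The count with no prescribed points, where the correlation determinant is empty.
  have hZ : (partitionFunction a b c : ℝ) =
      ((upMatrix M ^ (b + c)).submatrix (blockEmb h0 : Fin a ↪o Window M) (blockEmb hc)).det := by
    have h := ncard_upPaths_through (b := b) h0 hc (k := 0) (r := Fin.elim0) (q := Fin.elim0)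
      (fun i => i.elim0)
    rw [Matrix.det_isEmpty (n := Fin 0), mul_one] at h
    rw [← h, partitionFunction_eq, ← hbij.image_eq, hbij.injOn.ncard_image]
    congr 2
    ext
    simp
  have hcount : (nonintersectingConfigs a b c ∩ {z | ∀ i, p i ∈ particles z}).ncard =
      {y ∈ upPaths b c (blockEmb h0 : Fin a ↪o Window M) (blockEmb hc) |
        ∀ i, ∃ j, y (r i).castSucc j = q i}.ncard := by
    rw [← (hbij.injOn.mono (Set.sep_subset _ _)).ncard_image, ← hbij.image_eq]
    congr 1
    ext z
    have hmem : ∀ y : Fin (b + c + 1) → Fin a ↪o Window M,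
        (∀ i, p i ∈ particles (configOfUpPath y)) ↔ ∀ i, ∃ j, y (r i).castSucc j = q i :=
      fun y => forall_congr' fun i => mem_particles_configOfUpPath y (p i).1 (p i).2 (q i) rfl
    constructor
    · rintro ⟨⟨y, hy, rfl⟩, h⟩
      exact ⟨y, ⟨hy, (hmem y).1 h⟩, rfl⟩
    · rintro ⟨y, ⟨hy, h⟩, rfl⟩
      exact ⟨⟨y, hy, rfl⟩, (hmem y).2 h⟩
  rw [configMeasure_eq_uniformOn hb, uniformOn_real_nonintersectingConfigs hb, hcount,
    ncard_upPaths_through h0 hc hinj,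
    correlationMatrix_eq_hahnKernel ha hbc h0 hc r (fun i => (p i).2) q fun _ => rfl, ← hZ,
    mul_div_cancel_left₀ _ (Nat.cast_ne_zero.2 (partitionFunction_pos hb).ne')]

end Measures

theorem theorem3p1 (a b c : ℕ) (ha : 0 < a) (hb : 0 < b) (hbc : b ≤ c) :
    -- the determinantal weights define a probability measure
    IsProbabilityMeasure (configMeasure a b c) ∧
    -- it is the law of the conditioned random walks
    (∀ (Ω : Type*) [MeasurableSpace Ω] (P : Measure Ω) [IsProbabilityMeasure P]
        (ξ : Fin a → ℕ → Ω → ℤ), IsFairSteps P ξ →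
      P (nonintersectionEvent b c ξ) ≠ 0 ∧
      Measure.map (fun ω (r : InnerTime b c) j => walk ξ j r ω)
        (ProbabilityTheory.cond P (nonintersectionEvent b c ξ)) = configMeasure a b c) ∧
    -- at time `r` all particles sit on the lattice `α_r + 2ℤ`
    (∀ᵐ z ∂configMeasure a b c, ∀ (r : InnerTime b c) j, ∃ x : ℤ, z r j = alphaPar b r + 2 * x) ∧
    -- the particles form a determinantal process with the extended Hahn kernel
    IsDeterminantal (configMeasure a b c) particles
      (fun p q => hahnKernel a b c p.1 p.2 q.1 q.2) := by
  refine ⟨?_, fun Ω _ P _ ξ hξ => hξ.map_cond hb, ae_mem_lattice hb,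
    isDeterminantal_configMeasure ha hb hbc⟩
  rw [configMeasure_eq_uniformOn hb]
  exact isProbabilityMeasure_uniformOn (finite_nonintersectingConfigs hb)
    (nonempty_nonintersectingConfigs hb)
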